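/- For $x,y\in\mathbb R^n\setminus\{0\}$ let $\mathrm{ang}(x,y)\in[0,1]$ be the angle between $x$ and $y$ divided by $\pi$; for binary vectors $a,b$ of length $m$ let $\|a,b\|_H$ be the number of entries in which they differ; for bounded $T\subset\mathbb R^n$ let $\omega(T)=\mathbb E\sup_{v\in T}\langle g,v\rangle$ with $g\sim\mathcal N(0,I_n)$. For $K\subset S^{n-1}$ and $\varepsilon>0$ let $N_\varepsilon$ be the least number of closed Euclidean balls of radius $\varepsilon$ with centres in $K$ that cover $K$, and let $K_\varepsilon=\{a-b : a,b\in K,\ \|a-b\|_2\le\varepsilon\}$. There are absolute constants $c,c_1,c_2,c_{low},c_{up}>0$ such that the following holds for all $n,m$, all $K\subset S^{n-1}$ and all $\delta\in(0,1)$. Let $A\in\mathbb R^{m\times n}$ have independent $\mathcal N(0,1)$ entries, let $f(x)=\mathrm{sgn}(Ax)$, and put $\varepsilon=c\,\delta/\sqrt{\log(1/\delta)}$. (1) If $m\ge c_1\max\{\delta^{-2}\log N_\varepsilon,\ \delta^{-3}\omega^2(K_\varepsilon)\}$, then with probability at least $1-\exp(-c_2\delta^2m)$ the map $f$ is a $\delta$-binary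 embedding of $K$: for all $x,y\in K$, $\left|\frac1m\|f(x),f(y)\|_H-\mathrm{ang}(x,y)\right|\le\delta$. (2) If $m\ge c_1\max\{\delta^{-1}\log N_\varepsilon,\ \delta^{-3}\omega^2(K_\varepsilon)\}$, then with probability at least $1-\exp(-c_2\delta m)$ the map $f$ is a local $\delta$-binary embedding of $K$ (with constants $c_{low},c_{up}$): for all $x,y\in K$ with $\|x-y\|_2\ge\delta$ one has $\frac1m\|f(x),f(y)\|_H\ge c_{low}\,\delta$, and for all $x,y\in K$ with $\|x-y\|_2\le\delta/\sqrt{\log(1/\delta)}$ one has $\left|\frac1m\|f(x),f(y)\|_H-\mathrm{ang}(x,y)\right|\le c_{up}\,\delta$. -/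

import Mathlib

open MeasureTheory ProbabilityTheory

noncomputable section

/-- Normalized geodesic distance on the sphere: the angle between `x` and `y`, divided by `π`. -/
def ang {n : ℕ} (x y : EuclideanSpace ℝ (Fin n)) : ℝ :=
  InnerProductGeometry.angle x y / Real.pi

/-- Normalized Hamming distance of two binary vectors: the fraction of entries that differ. -/
def normHamming {m : ℕ} (a b : Fin m → Bool) : ℝ :=
  (hammingDist a b : ℝ) / m

/-- Gaussian width `ω(K) = 𝔼 sup_{v ∈ K} ⟪g, v⟫`, where `g` is a standard Gaussian vector. -/
def gaussianWidth {n : ℕ} (K : Set (EuclideanSpace ℝ (Fin n))) : ℝ :=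
  ∫ g, ⨆ v : K, inner ℝ g (v : EuclideanSpace ℝ (Fin n))
    ∂(stdGaussian (EuclideanSpace ℝ (Fin n)))

/-- The local set `K_ε`: differences of points of `K`, of norm at most `ε`. -/
def localSet {n : ℕ} (K : Set (EuclideanSpace ℝ (Fin n))) (ε : ℝ) :
    Set (EuclideanSpace ℝ (Fin n)) :=
  {v | ∃ a ∈ K, ∃ b ∈ K, v = a - b ∧ ‖a - b‖ ≤ ε}

/-- `log N_ε`, where `N_ε` is the least number of closed `ℓ₂`-balls of radius `ε`, centred at
points of `K`, that cover `K` (a finite number if `K` is bounded and `ε > 0`). -/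
def logCoveringNumber {n : ℕ} (K : Set (EuclideanSpace ℝ (Fin n))) (ε : ℝ) : ℝ :=
  Real.log ((Metric.coveringNumber ε.toNNReal K).toNat : ℝ)

/-- `f` is a `δ`-binary embedding of `K`. -/
def IsBinaryEmbedding {n m : ℕ} (δ : ℝ) (f : EuclideanSpace ℝ (Fin n) → (Fin m → Bool))
    (K : Set (EuclideanSpace ℝ (Fin n))) : Prop :=
  ∀ x ∈ K, ∀ y ∈ K, |normHamming (f x) (f y) - ang x y| ≤ δ

/-- `f` is a local `δ`-binary embedding of `K` with constants `cLow` and `cUp`: points of `K` at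
distance at least `δ` are separated by `f`, and the Hamming distance of close points is
accurate, both at scale `δ`. -/
def IsLocalBinaryEmbedding {n m : ℕ} (cLow cUp δ : ℝ)
    (f : EuclideanSpace ℝ (Fin n) → (Fin m → Bool))
    (K : Set (EuclideanSpace ℝ (Fin n))) : Prop :=
  (∀ x ∈ K, ∀ y ∈ K, δ ≤ ‖x - y‖ → cLow * δ ≤ normHamming (f x) (f y)) ∧
  (∀ x ∈ K, ∀ y ∈ K, ‖x - y‖ ≤ δ / Real.sqrt (Real.log δ⁻¹) →
    |normHamming (f x) (f y) - ang x y| ≤ cUp * δ)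

/-- The map `x ↦ sgn (A x)`; `true` stands for `+1`, `false` for `-1`, and `sgn 0 = +1`. -/
def signMap {n m : ℕ} (A : Matrix (Fin m) (Fin n) ℝ) (x : EuclideanSpace ℝ (Fin n)) :
    Fin m → Bool :=
  fun i => decide (0 ≤ A.mulVec x.ofLp i)

/-- The random matrix `A` has independent `N(0,1)` entries. -/
def IsStdGaussianMatrix {n m : ℕ} {Ω : Type*} [MeasurableSpace Ω] (P : Measure Ω)
    (A : Ω → Matrix (Fin m) (Fin n) ℝ) : Prop :=
  (∀ i j, HasLaw (fun ω => A ω i j) (gaussianReal 0 1) P) ∧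
  iIndepFun (fun (p : Fin m × Fin n) ω => A ω p.1 p.2) P

/-- The property `E` holds with probability at least `p`: it holds throughout some measurable
event of probability at least `p`. (The event `E` itself need not be measurable, since `K` is
an arbitrary set.) -/
def WithProbAtLeast {Ω : Type*} [MeasurableSpace Ω] (P : Measure Ω) (p : ℝ) (E : Ω → Prop) :
    Prop :=
  ∃ s : Set Ω, MeasurableSet s ∧ (∀ ω ∈ s, E ω) ∧ p ≤ P.real s

end

/-! ### Gaussian concentration for the support function of a bounded set -/

section GaussianSupremum

/-! The Hamming distance of the images of `x` and `y` counts the rows `g` of the matrix for which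
`⟪g, x⟫` and `⟪g, y⟫` have different signs. For fixed unit vectors this count is binomial with
success probability `ang x y` (`stdGaussian_sign_ne`). On a minimal `ε`-net of `K` a union bound
over pairs therefore suffices: Hoeffding's inequality for the global statement, Chernoff's for the
local one, where only constant factors at scale `δ` matter; this is why `δ⁻²` drops to `δ⁻¹` in
front of the entropy.

Passing from the net to `K` is the main point (`measure_exists_normHamming_net_le`). A row that
flips between `x` and its net point `y` has `|⟪g, y⟫| ≤ β` or `|⟪g, x - y⟫| > β`, with `β` of order
`δ`. The first kind is counted by Chernoff's inequality and a union bound over the net. The second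
must be counted uniformly over `v = x - y` in the local set. If `k` rows satisfy `|⟪a i, v⟫| > β`,
their sum with suitable signs has inner product at least `β k` with `v`. For fixed signs this sum is
distributed as `√k` times a standard Gaussian vector, so the supremum of the Gaussian process over
the local set would reach `β √k`. With `k` of order `δ m`, the hypothesis `m ≳ δ⁻³ ω²` makes `β √k`
at least twice the width, and concentration, with deviation scale `ε`, bounds the probability by
`exp (-2 D k)` with `D` of order `β² / ε²`, hence of order `log (1/δ)`. One half of this exponent
pays for the choice of the signed rows; this is the purpose of the factor `√(log (1/δ))` in `ε`.

As `δ → 1` the radius `ε` tends to infinity and a net at that radius says nothing. For `δ > 1/2`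
everything is deduced from the scale `1/2`. The entropy at the smaller radius is recovered from the
local width by a weak Sudakov minoration (`log_card_le_gaussianWidth_sq`,
`logCoveringNumber_le_add`).

The probability bounds carry no factor in front of the exponential, so bounded values of `δ m` need
separate care: there the entropy hypothesis forces the net to have at most one point. -/

lemma lintegral_ofReal_exp {Ω : Type*} [MeasurableSpace Ω] {μ : Measure Ω} {f : Ω → ℝ}
    (h : Integrable (fun x => Real.exp (f x)) μ) :
    ∫⁻ x, ENNReal.ofReal (Real.exp (f x)) ∂μ = ENNReal.ofReal (∫ x, Real.exp (f x) ∂μ) :=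
  (ofReal_integral_eq_lintegral_ofReal h (ae_of_all _ fun _ => (Real.exp_pos _).le)).symm

variable {E : Type*} [NormedAddCommGroup E] [InnerProductSpace ℝ E]

/-- The support function of a set. -/
noncomputable def supInner (T : Set E) (x : E) : ℝ := ⨆ v : T, inner ℝ x (v : E)

lemma bddAbove_inner {T : Set E} {σ : ℝ} (hT : ∀ v ∈ T, ‖v‖ ≤ σ) (x : E) :
    BddAbove (Set.range fun v : T => inner ℝ x (v : E)) := by
  refine ⟨‖x‖ * σ, ?_⟩
  rintro _ ⟨v, rfl⟩
  exact (real_inner_le_norm x v).trans (by gcongr; exact hT v v.2)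

lemma inner_le_supInner {T : Set E} {σ : ℝ} (hT : ∀ v ∈ T, ‖v‖ ≤ σ) (x : E) {v : E} (hv : v ∈ T) :
    inner ℝ x v ≤ supInner T x :=
  le_ciSup (bddAbove_inner hT x) ⟨v, hv⟩

lemma supInner_le {T : Set E} (hne : T.Nonempty) {x : E} {b : ℝ} (h : ∀ v ∈ T, inner ℝ x v ≤ b) :
    supInner T x ≤ b := by
  have := hne.to_subtype
  exact ciSup_le fun v => h v v.2

lemma supInner_mono {S T : Set E} {σ : ℝ} (hT : ∀ v ∈ T, ‖v‖ ≤ σ) (hne : S.Nonempty) (h : S ⊆ T)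
    (x : E) : supInner S x ≤ supInner T x :=
  supInner_le hne fun _ hv => inner_le_supInner hT x (h hv)

lemma supInner_sub_le {T : Set E} (hne : T.Nonempty) {σ : ℝ} (hT : ∀ v ∈ T, ‖v‖ ≤ σ) (x y : E) :
    supInner T x ≤ supInner T y + σ * ‖x - y‖ := by
  refine supInner_le hne fun v hv => ?_
  have h1 := inner_le_supInner hT y hv
  have h2 : inner ℝ (x - y) v ≤ ‖x - y‖ * σ :=
    (real_inner_le_norm _ _).trans (by gcongr; exact hT v hv)
  rw [inner_sub_left] at h2
  linarith

lemma abs_supInner_le {T : Set E} (hne : T.Nonempty) {σ : ℝ} (hT : ∀ v ∈ T, ‖v‖ ≤ σ) (x : E) :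
    |supInner T x| ≤ σ * ‖x‖ := by
  have h0 : supInner T 0 = 0 := by
    have := hne.to_subtype
    simp [supInner]
  have h1 := supInner_sub_le hne hT x 0
  have h2 := supInner_sub_le hne hT 0 x
  rw [abs_le]
  simp [h0] at h1 h2
  constructor <;> linarith

lemma continuous_supInner {T : Set E} (hne : T.Nonempty) {σ : ℝ} (hT : ∀ v ∈ T, ‖v‖ ≤ σ) :
    Continuous (supInner T) := by
  obtain ⟨v, hv⟩ := hne
  have hσ : 0 ≤ σ := (norm_nonneg v).trans (hT v hv)
  refine (LipschitzWith.of_le_add_mul ⟨σ, hσ⟩ fun x y => ?_).continuous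
  rw [dist_eq_norm]
  exact supInner_sub_le ⟨v, hv⟩ hT x y

lemma supInner_smul {T : Set E} {t : ℝ} (ht : 0 ≤ t) (x : E) :
    supInner T (t • x) = t * supInner T x := by
  simp [supInner, inner_smul_left, Real.mul_iSup_of_nonneg ht]

variable [FiniteDimensional ℝ E] [MeasurableSpace E] [BorelSpace E]

/-- The supremum need not be attained, so an error `ρ` is allowed. Choosing the first good index in
a dense sequence of `T` makes the choice measurable, as Fubini's theorem will require. -/
lemma exists_measurable_almost_maximizer {T : Set E} (hne : T.Nonempty) {σ : ℝ}
    (hT : ∀ v ∈ T, ‖v‖ ≤ σ) {ρ : ℝ} (hρ : 0 < ρ) :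
    ∃ s : E → E, Measurable s ∧ ∀ x, s x ∈ T ∧ supInner T x ≤ inner ℝ x (s x) + ρ := by
  classical
  have := hne.to_subtype
  let d : ℕ → E := fun k => (TopologicalSpace.denseSeq T k : E)
  have hd : ∀ x, ∃ k, supInner T x < inner ℝ x (d k) + ρ := by
    intro x
    obtain ⟨v, hv⟩ : ∃ v : T, supInner T x - ρ < inner ℝ x (v : E) :=
      exists_lt_of_lt_ciSup (by rw [supInner]; linarith)
    have hopen : IsOpen {w : T | supInner T x - ρ < inner ℝ x (w : E)} :=
      isOpen_lt continuous_const (by fun_prop)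
    obtain ⟨k, hk⟩ := (TopologicalSpace.denseRange_denseSeq T).exists_mem_open hopen ⟨v, hv⟩
    exact ⟨k, by simp only [Set.mem_ofPred_eq] at hk; simp only [d]; linarith⟩
  have hF := continuous_supInner hne hT
  refine ⟨fun x => d (Nat.find (hd x)), ?_, fun x => ⟨Subtype.coe_prop _, (Nat.find_spec (hd x)).le⟩⟩
  refine (measurable_from_nat (f := d)).comp (measurable_find hd fun k => ?_)
  exact measurableSet_lt hF.measurable (by fun_prop)

lemma map_inner_stdGaussian (v : E) :
    (stdGaussian E).map (fun x => inner ℝ x v) = gaussianReal 0 (‖v‖₊ ^ 2) := by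
  have : IsProbabilityMeasure ((stdGaussian E).map (fun x => inner ℝ x v)) :=
    Measure.isProbabilityMeasure_map (by fun_prop)
  refine Measure.ext_of_charFun ?_
  ext t
  rw [charFun_gaussianReal, charFun_apply, integral_map (by fun_prop) (by fun_prop)]
  have := charFun_stdGaussian (t • v)
  rw [charFun_apply] at this
  simp only [inner_smul_right] at this
  simp only [RCLike.inner_apply, conj_trivial]
  rw [this]
  congr 1
  have h2 : ‖t • v‖ ^ 2 = ‖v‖ ^ 2 * t ^ 2 := by rw [norm_smul, mul_pow, Real.norm_eq_abs, sq_abs]; ring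
  rw [← Complex.ofReal_pow, h2]
  push_cast
  simp
  ring

lemma mgf_inner_stdGaussian (v : E) (t : ℝ) :
    mgf (fun x => inner ℝ x v) (stdGaussian E) t = Real.exp (‖v‖ ^ 2 * t ^ 2 / 2) := by
  rw [mgf_gaussianReal (map_inner_stdGaussian v)]
  simp

/-- Fernique's theorem, after completing the square: `t ‖x‖ ≤ t² / (4C) + C ‖x‖²`. -/
lemma integrable_exp_mul_norm_stdGaussian (t : ℝ) :
    Integrable (fun x => Real.exp (t * ‖x‖)) (stdGaussian E) := by
  obtain ⟨C, hC, h⟩ := IsGaussian.exists_integrable_exp_sq (stdGaussian E)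
  refine (h.const_mul (Real.exp (t ^ 2 / (4 * C)))).mono' (by fun_prop) (ae_of_all _ fun x => ?_)
  rw [Real.norm_eq_abs, Real.abs_exp, ← Real.exp_add]
  gcongr
  have : t ^ 2 / (4 * C) + C * ‖x‖ ^ 2 - t * ‖x‖ = (2 * C * ‖x‖ - t) ^ 2 / (4 * C) := by
    field_simp; ring
  have h2 : 0 ≤ (2 * C * ‖x‖ - t) ^ 2 / (4 * C) := by positivity
  linarith

lemma integrable_norm_stdGaussian : Integrable (fun x : E => ‖x‖) (stdGaussian E) :=
  IsGaussian.integrable_id.norm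

lemma integrable_supInner {T : Set E} (hne : T.Nonempty) {σ : ℝ} (hT : ∀ v ∈ T, ‖v‖ ≤ σ) :
    Integrable (supInner T) (stdGaussian E) := by
  refine (integrable_norm_stdGaussian.const_mul σ).mono'
    (continuous_supInner hne hT).aestronglyMeasurable (ae_of_all _ fun x => ?_)
  exact abs_supInner_le hne hT x

lemma integrable_exp_mul_supInner {T : Set E} (hne : T.Nonempty) {σ : ℝ} (hT : ∀ v ∈ T, ‖v‖ ≤ σ)
    (t : ℝ) : Integrable (fun x => Real.exp (t * supInner T x)) (stdGaussian E) := by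
  have hc := continuous_supInner hne hT
  refine (integrable_exp_mul_norm_stdGaussian (|t| * σ)).mono'
    (by fun_prop) (ae_of_all _ fun x => ?_)
  rw [Real.norm_eq_abs, Real.abs_exp, Real.exp_le_exp]
  calc t * supInner T x ≤ |t * supInner T x| := le_abs_self _
    _ = |t| * |supInner T x| := abs_mul _ _
    _ ≤ |t| * (σ * ‖x‖) := by gcongr; exact abs_supInner_le hne hT x
    _ = _ := by ring

/-- One discretization of the path between two independent copies of a Gaussian vector bounds the
exponential moment of the increment of the support function. -/
lemma lintegral_exp_supInner_increment_le {T : Set E} (hne : T.Nonempty) {σ : ℝ}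
    (hT : ∀ v ∈ T, ‖v‖ ≤ σ) {t : ℝ} (ht : 0 ≤ t) {ρ : ℝ} (hρ : 0 < ρ) (N : ℕ) (hN : 0 < N) :
    ∫⁻ p, ENNReal.ofReal (Real.exp (t * (supInner T p.2 - supInner T p.1)))
        ∂((stdGaussian E).prod (stdGaussian E)) ≤
      ENNReal.ofReal (Real.exp (t * N * ρ + σ ^ 2 * (t * N * Real.sin (Real.pi / (2 * N))) ^ 2 / 2) *
        ∫ x, Real.exp (t * N * (1 - Real.cos (Real.pi / (2 * N))) * σ * ‖x‖) ∂(stdGaussian E)) := by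
  obtain ⟨s, hsm, hs⟩ := exists_measurable_almost_maximizer hne hT hρ
  set γ := stdGaussian E
  set h : ℝ := Real.pi / (2 * N) with hh
  have hN' : (0 : ℝ) < N := by exact_mod_cast hN
  set F := supInner T
  have hFc : Continuous F := continuous_supInner hne hT
  -- `G` bounds one step of the path `cos (jh) x + sin (jh) y`. Its maximizer depends on the first
  -- component only, so conditionally on that component the last term is Gaussian with variance at
  -- most `σ² sin² h`.
  let G : E × E → ℝ := fun p =>
    ρ + (1 - Real.cos h) * (σ * ‖p.1‖) + Real.sin h * inner ℝ p.2 (s p.1)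
  have hGm : Measurable G := by
    have : Measurable fun p : E × E => inner ℝ p.2 (s p.1) :=
      Measurable.inner measurable_snd (hsm.comp measurable_fst)
    fun_prop
  let R : ℕ → E × E → E × E := fun j => ContinuousLinearMap.rotation (j * h)
  have hR : ∀ j, MeasurePreserving (R j) (γ.prod γ) (γ.prod γ) := fun j =>
    ⟨by fun_prop, IsGaussian.map_rotation_eq_self (by simp [γ]) _⟩
  have hstep : ∀ j p, F (R (j + 1) p).1 - F (R j p).1 ≤ G (R (j + 1) p) := by
    intro j p
    have e : (R j p).1 = Real.cos h • (R (j + 1) p).1 - Real.sin h • (R (j + 1) p).2 := by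
      simp only [R, ContinuousLinearMap.rotation_apply]
      have h1 : ((j : ℝ) * h) = ((j + 1 : ℕ) : ℝ) * h - h := by push_cast; ring
      rw [h1, Real.cos_sub, Real.sin_sub]
      module
    set q := R (j + 1) p
    obtain ⟨hm, hle⟩ := hs q.1
    have h1 := inner_le_supInner hT (R j p).1 hm
    rw [e, inner_sub_left, inner_smul_left, inner_smul_left] at h1
    simp only [conj_trivial] at h1
    have h2 : inner ℝ q.1 (s q.1) ≤ σ * ‖q.1‖ :=
      (inner_le_supInner hT _ hm).trans ((le_abs_self _).trans (abs_supInner_le hne hT _))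
    have h3 : (1 - Real.cos h) * inner ℝ q.1 (s q.1) ≤ (1 - Real.cos h) * (σ * ‖q.1‖) := by
      apply mul_le_mul_of_nonneg_left h2
      linarith [Real.cos_le_one h]
    rw [← e] at h1
    simp only [G, F]
    linarith
  have htot : ∀ p : E × E, Real.exp (t * (F p.2 - F p.1)) ≤
      ∑ j ∈ Finset.range N, (1 / N : ℝ) * Real.exp (t * N * G (R (j + 1) p)) := by
    intro p
    have h0 : (R 0 p).1 = p.1 := by simp [R, ContinuousLinearMap.rotation_apply]
    have hNN : (R N p).1 = p.2 := by
      have : (N : ℝ) * h = Real.pi / 2 := by rw [hh]; field_simp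
      simp [R, ContinuousLinearMap.rotation_apply, this]
    have h1 : F p.2 - F p.1 ≤ ∑ j ∈ Finset.range N, G (R (j + 1) p) := by
      rw [← h0, ← hNN, ← Finset.sum_range_sub (fun j => F (R j p).1)]
      exact Finset.sum_le_sum fun j _ => hstep j p
    -- Jensen turns the exponential of the sum over the path into an average of exponentials; by
    -- rotation invariance all of these have the same mean.
    have h2 := convexOn_exp.map_sum_le (t := Finset.range N) (w := fun _ => (1 / N : ℝ))
      (p := fun j => t * N * G (R (j + 1) p)) (fun _ _ => by positivity)
      (by simp; field_simp) (fun _ _ => Set.mem_univ _)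
    simp only [smul_eq_mul] at h2
    refine le_trans ?_ h2
    gcongr
    calc t * (F p.2 - F p.1) ≤ t * ∑ j ∈ Finset.range N, G (R (j + 1) p) := by gcongr
      _ = _ := by
        rw [Finset.mul_sum]
        refine Finset.sum_congr rfl fun j _ => ?_
        field_simp
  have hGE : Measurable fun p => ENNReal.ofReal (Real.exp (t * N * G p)) := by fun_prop
  have hint : ∫⁻ p, ENNReal.ofReal (Real.exp (t * N * G p)) ∂(γ.prod γ) ≤
      ENNReal.ofReal (Real.exp (t * N * ρ + σ ^ 2 * (t * N * Real.sin h) ^ 2 / 2) *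
        ∫ x, Real.exp (t * N * (1 - Real.cos h) * σ * ‖x‖) ∂γ) := by
    rw [lintegral_prod _ hGE.aemeasurable, ENNReal.ofReal_mul (Real.exp_pos _).le,
      ← lintegral_ofReal_exp (by exact integrable_exp_mul_norm_stdGaussian _),
      ← lintegral_const_mul _ (by fun_prop)]
    refine lintegral_mono fun x => ?_
    have e : ∀ y, Real.exp (t * N * G (x, y)) =
        Real.exp (t * N * ρ + t * N * (1 - Real.cos h) * σ * ‖x‖) *
        Real.exp ((t * N * Real.sin h) * inner ℝ y (s x)) := by
      intro y
      rw [← Real.exp_add]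
      congr 1
      simp only [G]; ring
    simp only [e]
    have hmg := mgf_inner_stdGaussian (s x) (t * N * Real.sin h)
    have hi : Integrable (fun y => Real.exp ((t * N * Real.sin h) * inner ℝ y (s x))) γ := by
      by_contra hc
      rw [mgf, integral_undef hc] at hmg
      exact absurd hmg.symm (Real.exp_pos _).ne'
    simp only [ENNReal.ofReal_mul (Real.exp_pos _).le]
    rw [lintegral_const_mul _ (by fun_prop), lintegral_ofReal_exp hi]
    rw [mgf] at hmg
    rw [hmg, ← ENNReal.ofReal_mul (Real.exp_pos _).le, ← ENNReal.ofReal_mul (Real.exp_pos _).le,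
      ← Real.exp_add, ← Real.exp_add]
    apply ENNReal.ofReal_le_ofReal
    rw [Real.exp_le_exp]
    have : ‖s x‖ ^ 2 ≤ σ ^ 2 := by gcongr; exact hT _ (hs x).1
    nlinarith [sq_nonneg (t * N * Real.sin h)]
  calc _ ≤ ∫⁻ p, ∑ j ∈ Finset.range N, ENNReal.ofReal (1 / N) *
        ENNReal.ofReal (Real.exp (t * N * G (R (j + 1) p))) ∂(γ.prod γ) := by
        refine lintegral_mono fun p => ?_
        refine (ENNReal.ofReal_le_ofReal (htot p)).trans (le_of_eq ?_)
        rw [ENNReal.ofReal_sum_of_nonneg (fun _ _ => by positivity)]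
        exact Finset.sum_congr rfl fun j _ => ENNReal.ofReal_mul (by positivity)
    _ = ∑ j ∈ Finset.range N, ENNReal.ofReal (1 / N) *
        ∫⁻ p, ENNReal.ofReal (Real.exp (t * N * G p)) ∂(γ.prod γ) := by
        have hm : ∀ j, Measurable fun p => ENNReal.ofReal (Real.exp (t * N * G (R (j + 1) p))) :=
          fun j => hGE.comp (hR (j + 1)).measurable
        rw [lintegral_finsetSum _ (fun j _ => (hm j).const_mul _)]
        refine Finset.sum_congr rfl fun j _ => ?_
        rw [lintegral_const_mul _ (hm j), ← (hR (j + 1)).lintegral_comp hGE]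
    _ = ∫⁻ p, ENNReal.ofReal (Real.exp (t * N * G p)) ∂(γ.prod γ) := by
        rw [← Finset.sum_mul, Finset.sum_const, Finset.card_range, nsmul_eq_mul,
          ← ENNReal.ofReal_natCast, ← ENNReal.ofReal_mul (by positivity)]
        rw [mul_one_div_cancel hN'.ne']; simp
    _ ≤ _ := hint

/-- The Maurey–Pisier argument: compare with an independent copy along a quarter circle, then let
the mesh tend to zero. The length `π / 2` of the arc enters the variance. -/
lemma mgf_supInner_le {T : Set E} (hne : T.Nonempty) {σ : ℝ} (hT : ∀ v ∈ T, ‖v‖ ≤ σ) {t : ℝ}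
    (ht : 0 ≤ t) :
    mgf (supInner T) (stdGaussian E) t ≤
      Real.exp (t * (∫ x, supInner T x ∂(stdGaussian E)) + σ ^ 2 * (t * (Real.pi / 2)) ^ 2 / 2) := by
  set γ := stdGaussian E
  have hFc : Continuous (supInner T) := continuous_supInner hne hT
  have hσ : 0 ≤ σ := by
    obtain ⟨v, hv⟩ := hne
    exact (norm_nonneg v).trans (hT v hv)
  -- Jensen in the independent copy, `𝔼 exp (-tF) ≥ exp (-t 𝔼F)`, removes that copy from the lower
  -- bound.
  have hlow : ENNReal.ofReal (mgf (supInner T) γ t * Real.exp (-t * ∫ x, supInner T x ∂γ)) ≤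
      ∫⁻ p, ENNReal.ofReal (Real.exp (t * (supInner T p.2 - supInner T p.1))) ∂(γ.prod γ) := by
    rw [lintegral_prod_symm _ (by fun_prop)]
    have e : ∀ x y, ENNReal.ofReal (Real.exp (t * (supInner T y - supInner T x))) =
        ENNReal.ofReal (Real.exp (t * supInner T y)) *
          ENNReal.ofReal (Real.exp (-t * supInner T x)) := by
      intro x y
      rw [← ENNReal.ofReal_mul (Real.exp_pos _).le, ← Real.exp_add]
      ring_nf
    simp only [e]
    simp_rw [lintegral_const_mul _ (show Measurable fun x =>
      ENNReal.ofReal (Real.exp (-t * supInner T x)) by fun_prop)]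
    rw [lintegral_mul_const _ (by fun_prop), lintegral_ofReal_exp (integrable_exp_mul_supInner hne hT t),
      lintegral_ofReal_exp (integrable_exp_mul_supInner hne hT (-t)),
      ENNReal.ofReal_mul mgf_nonneg]
    refine mul_le_mul_right (ENNReal.ofReal_le_ofReal ?_) _
    have := convexOn_exp.map_integral_le (μ := γ) (f := fun x => -t * supInner T x)
      Real.continuous_exp.continuousOn isClosed_univ (by simp)
      ((integrable_supInner hne hT).const_mul _) (integrable_exp_mul_supInner hne hT (-t))
    rwa [integral_const_mul] at this
  have hN : ∀ N : ℕ, 0 < N → mgf (supInner T) γ t * Real.exp (-t * ∫ x, supInner T x ∂γ) ≤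
      Real.exp (t * (1 / N) + σ ^ 2 * (t * (Real.pi / 2)) ^ 2 / 2) *
        mgf (fun x => ‖x‖) γ (t * σ * (Real.pi ^ 2 / 8) * (1 / N)) := by
    intro N hN
    have hN' : (0 : ℝ) < N := by exact_mod_cast hN
    -- The choice `ρ = 1 / N²` makes the accumulated error `t N ρ` vanish in the limit.
    have h1 := hlow.trans (lintegral_exp_supInner_increment_le hne hT ht
      (ρ := 1 / (N : ℝ) ^ 2) (by positivity) N hN)
    rw [ENNReal.ofReal_le_ofReal_iff (mul_nonneg (Real.exp_pos _).le
      (integral_nonneg fun _ => (Real.exp_pos _).le))] at h1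
    refine h1.trans ?_
    set h : ℝ := Real.pi / (2 * N) with hh
    have hh0 : 0 < h := by positivity
    have hle1 : t * N * (1 / (N : ℝ) ^ 2) = t * (1 / N) := by field_simp
    have hsin0 : 0 ≤ Real.sin h := by
      apply Real.sin_nonneg_of_nonneg_of_le_pi hh0.le
      rw [hh, div_le_iff₀ (by positivity)]
      have : (1 : ℝ) ≤ N := by exact_mod_cast hN
      nlinarith [Real.pi_pos]
    have hsin : N * Real.sin h ≤ Real.pi / 2 := by
      calc N * Real.sin h ≤ N * h := by gcongr; exact Real.sin_le hh0.le
        _ = _ := by rw [hh]; field_simp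
    have hcos : N * (1 - Real.cos h) ≤ Real.pi ^ 2 / 8 * (1 / N) := by
      have := Real.one_sub_sq_div_two_le_cos (x := h)
      calc N * (1 - Real.cos h) ≤ N * (h ^ 2 / 2) := by gcongr; linarith
        _ = _ := by rw [hh]; field_simp; ring
    refine mul_le_mul ?_ ?_ (integral_nonneg fun _ => (Real.exp_pos _).le) (Real.exp_pos _).le
    · rw [Real.exp_le_exp, hle1, mul_assoc t]
      gcongr
    · refine integral_mono (by exact integrable_exp_mul_norm_stdGaussian _)
        (by exact integrable_exp_mul_norm_stdGaussian _) fun x => ?_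
      simp only
      rw [Real.exp_le_exp]
      refine mul_le_mul_of_nonneg_right ?_ (norm_nonneg _)
      calc t * N * (1 - Real.cos h) * σ = t * σ * (N * (1 - Real.cos h)) := by ring
        _ ≤ t * σ * (Real.pi ^ 2 / 8 * (1 / N)) := by gcongr
        _ = _ := by ring
  have hlim : Filter.Tendsto (fun N : ℕ =>
      Real.exp (t * (1 / N) + σ ^ 2 * (t * (Real.pi / 2)) ^ 2 / 2) *
        mgf (fun x => ‖x‖) γ (t * σ * (Real.pi ^ 2 / 8) * (1 / N))) Filter.atTop
      (nhds (Real.exp (t * 0 + σ ^ 2 * (t * (Real.pi / 2)) ^ 2 / 2) *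
        mgf (fun x => ‖x‖) γ (t * σ * (Real.pi ^ 2 / 8) * 0))) := by
    have h0 : Filter.Tendsto (fun N : ℕ => (1 : ℝ) / N) Filter.atTop (nhds 0) :=
      tendsto_one_div_atTop_nhds_zero_nat
    have hcm : Continuous (mgf (fun x : E => ‖x‖) γ) :=
      continuous_mgf integrable_exp_mul_norm_stdGaussian
    have hcont : Continuous fun u : ℝ =>
        Real.exp (t * u + σ ^ 2 * (t * (Real.pi / 2)) ^ 2 / 2) *
          mgf (fun x => ‖x‖) γ (t * σ * (Real.pi ^ 2 / 8) * u) := by fun_prop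
    exact (hcont.tendsto 0).comp h0
  have := ge_of_tendsto hlim (Filter.eventually_atTop.2 ⟨1, fun N hn => hN N hn⟩)
  simp only [mul_zero, zero_add, mgf_zero, mul_one] at this
  rw [Real.exp_add]
  calc mgf (supInner T) γ t = mgf (supInner T) γ t * Real.exp (-t * ∫ x, supInner T x ∂γ) *
        Real.exp (t * ∫ x, supInner T x ∂γ) := by
        rw [mul_assoc, ← Real.exp_add]; simp
    _ ≤ Real.exp (σ ^ 2 * (t * (Real.pi / 2)) ^ 2 / 2) * Real.exp (t * ∫ x, supInner T x ∂γ) := by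
        gcongr
    _ = _ := mul_comm _ _

/-- **Gaussian concentration** for the support function of a bounded set. -/
theorem measure_supInner_ge_le {T : Set E} (hne : T.Nonempty) {σ : ℝ} (hσ : 0 < σ)
    (hT : ∀ v ∈ T, ‖v‖ ≤ σ) {u : ℝ} (hu : 0 ≤ u) :
    stdGaussian E {x | (∫ x, supInner T x ∂(stdGaussian E)) + u ≤ supInner T x} ≤
      ENNReal.ofReal (Real.exp (-(2 * u ^ 2 / (Real.pi ^ 2 * σ ^ 2)))) := by
  -- The minimizer of `-t u + σ² (t π / 2)² / 2`.
  set t := 4 * u / (Real.pi ^ 2 * σ ^ 2) with ht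
  have hpi := Real.pi_pos
  have ht0 : 0 ≤ t := by positivity
  have h1 := measure_ge_le_exp_mul_mgf (μ := stdGaussian E) 
    (X := supInner T) ((∫ x, supInner T x ∂(stdGaussian E)) + u) ht0
    (integrable_exp_mul_supInner hne hT t)
  have h2 := mgf_supInner_le hne hT ht0
  rw [ENNReal.le_ofReal_iff_toReal_le (measure_ne_top _ _) (Real.exp_pos _).le]
  refine h1.trans ((mul_le_mul_of_nonneg_left h2 (Real.exp_pos _).le).trans ?_)
  rw [← Real.exp_add, Real.exp_le_exp]
  apply le_of_eq
  rw [ht]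
  field_simp
  ring

end GaussianSupremum

/-! ### Angles and chords on the sphere -/

section Angle

variable {n : ℕ} {x y z : EuclideanSpace ℝ (Fin n)}

lemma norm_sub_eq_two_mul_sin (hx : ‖x‖ = 1) (hy : ‖y‖ = 1) :
    ‖x - y‖ = 2 * Real.sin (InnerProductGeometry.angle x y / 2) := by
  set θ := InnerProductGeometry.angle x y
  have h0 : 0 ≤ θ := InnerProductGeometry.angle_nonneg x y
  have hpi : θ ≤ Real.pi := InnerProductGeometry.angle_le_pi x y
  have hs : 0 ≤ Real.sin (θ / 2) := Real.sin_nonneg_of_nonneg_of_le_pi (by linarith) (by linarith)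
  have hc : inner ℝ x y = Real.cos θ := by
    rw [InnerProductGeometry.cos_angle, hx, hy]; simp
  have hsq : ‖x - y‖ ^ 2 = (2 * Real.sin (θ / 2)) ^ 2 := by
    rw [norm_sub_sq_real, hx, hy, hc]
    have : Real.cos θ = 1 - 2 * Real.sin (θ / 2) ^ 2 := by
      have h := Real.cos_two_mul (θ / 2)
      have h' := Real.sin_sq_add_cos_sq (θ / 2)
      rw [mul_div_cancel₀ θ two_ne_zero] at h
      linarith
    rw [this]; ring
  exact (pow_left_inj₀ (norm_nonneg _) (by positivity) two_ne_zero).1 hsq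

/-- Jordan's inequality `sin u ≥ 2u / π` on `[0, π/2]`, applied to half the angle. -/
lemma ang_le_norm_sub_div_two (hx : ‖x‖ = 1) (hy : ‖y‖ = 1) : ang x y ≤ ‖x - y‖ / 2 := by
  rw [norm_sub_eq_two_mul_sin hx hy, ang]
  have h0 := InnerProductGeometry.angle_nonneg x y
  have hpi := InnerProductGeometry.angle_le_pi x y
  have := Real.mul_le_sin (x := InnerProductGeometry.angle x y / 2) (by linarith) (by linarith)
  calc _ = 2 / Real.pi * (InnerProductGeometry.angle x y / 2) := by ring
    _ ≤ _ := by linarith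

lemma norm_sub_div_pi_le_ang (hx : ‖x‖ = 1) (hy : ‖y‖ = 1) : ‖x - y‖ / Real.pi ≤ ang x y := by
  rw [norm_sub_eq_two_mul_sin hx hy, ang]
  have h0 := InnerProductGeometry.angle_nonneg x y
  have := Real.sin_le (x := InnerProductGeometry.angle x y / 2) (by linarith)
  have := Real.pi_pos
  gcongr
  linarith

lemma ang_nonneg (x y : EuclideanSpace ℝ (Fin n)) : 0 ≤ ang x y :=
  div_nonneg (InnerProductGeometry.angle_nonneg x y) Real.pi_pos.le

lemma ang_le_one (x y : EuclideanSpace ℝ (Fin n)) : ang x y ≤ 1 :=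
  div_le_one_of_le₀ (InnerProductGeometry.angle_le_pi x y) Real.pi_pos.le

lemma ang_comm (x y : EuclideanSpace ℝ (Fin n)) : ang x y = ang y x := by
  rw [ang, ang, InnerProductGeometry.angle_comm]

lemma ang_triangle (x y z : EuclideanSpace ℝ (Fin n)) : ang x z ≤ ang x y + ang y z := by
  rw [ang, ang, ang, ← add_div]
  have := Real.pi_pos
  gcongr
  exact InnerProductGeometry.angle_le_angle_add_angle x y z

end Angle

/-! ### Gaussian measure of planar wedges -/

section PlanarGaussian

/-- The standard Gaussian measure on the plane. -/
noncomputable def planarGaussian : Measure (ℝ × ℝ) := (gaussianReal 0 1).prod (gaussianReal 0 1)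

instance : IsProbabilityMeasure planarGaussian := by unfold planarGaussian; infer_instance

lemma planarGaussian_apply {D : Set (ℝ × ℝ)} (hD : MeasurableSet D) :
    planarGaussian D = ∫⁻ p, D.indicator (fun p => gaussianPDF 0 1 p.1 * gaussianPDF 0 1 p.2) p := by
  rw [planarGaussian, gaussianReal_of_var_ne_zero _ one_ne_zero,
    prod_withDensity (measurable_gaussianPDF _ _) (measurable_gaussianPDF _ _),
    withDensity_apply _ hD, ← lintegral_indicator hD]
  rfl

/-- The radial mass per unit of angle. -/
noncomputable def radialMass : ENNReal :=
  ∫⁻ r in Set.Ioi (0 : ℝ), ENNReal.ofReal r * ENNReal.ofReal ((2 * Real.pi)⁻¹ * Real.exp (-r ^ 2 / 2))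

/-- In polar coordinates the density does not depend on the angle, so the mass of a cone is
proportional to its angular width. -/
lemma planarGaussian_eq_radialMass_mul {D : Set (ℝ × ℝ)} (hD : MeasurableSet D) {J : Set ℝ}
    (hJ : MeasurableSet J) (h : ∀ r > 0, ∀ φ ∈ Set.Ioo (-Real.pi) Real.pi,
      ((r * Real.cos φ, r * Real.sin φ) ∈ D ↔ φ ∈ J)) :
    planarGaussian D = radialMass * volume (J ∩ Set.Ioo (-Real.pi) Real.pi) := by
  classical
  rw [planarGaussian_apply hD, ← lintegral_comp_polarCoord_symm, polarCoord_target]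
  have e : ∀ p ∈ Set.Ioi (0 : ℝ) ×ˢ Set.Ioo (-Real.pi) Real.pi,
      ENNReal.ofReal p.1 • D.indicator (fun p => gaussianPDF 0 1 p.1 * gaussianPDF 0 1 p.2)
        (polarCoord.symm p) =
      (ENNReal.ofReal p.1 * ENNReal.ofReal ((2 * Real.pi)⁻¹ * Real.exp (-p.1 ^ 2 / 2))) *
        J.indicator 1 p.2 := by
    rintro ⟨r, φ⟩ ⟨hr, hφ⟩
    have hiff := h r hr φ hφ
    rw [polarCoord_symm_apply]
    by_cases hm : φ ∈ J
    · rw [Set.indicator_of_mem (hiff.2 hm), Set.indicator_of_mem hm]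
      simp only [smul_eq_mul, Pi.one_apply, mul_one]
      congr 1
      rw [gaussianPDF, gaussianPDF, ← ENNReal.ofReal_mul (gaussianPDFReal_nonneg _ _ _)]
      congr 1
      simp only [gaussianPDFReal, NNReal.coe_one, mul_one, sub_zero]
      rw [mul_mul_mul_comm, ← Real.exp_add, ← mul_inv, Real.mul_self_sqrt (by positivity)]
      congr 2
      have := Real.sin_sq_add_cos_sq φ
      linear_combination (-r ^ 2 / 2) * this
    · rw [Set.indicator_of_notMem (fun hc => hm (hiff.1 hc)), Set.indicator_of_notMem hm]
      simp
  rw [setLIntegral_congr_fun (measurableSet_Ioi.prod measurableSet_Ioo) e, Measure.volume_eq_prod,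
    ← Measure.prod_restrict,
    lintegral_prod_mul (f := fun r : ℝ => ENNReal.ofReal r *
      ENNReal.ofReal ((2 * Real.pi)⁻¹ * Real.exp (-r ^ 2 / 2))) (g := J.indicator 1)
      (by fun_prop) ((measurable_one.indicator hJ).aemeasurable)]
  rw [lintegral_indicator_one hJ, Measure.restrict_apply hJ, radialMass]

/-- The whole plane is a cone of total mass one, which spares the evaluation of the radial integral.
-/
lemma radialMass_mul_two_pi : radialMass * ENNReal.ofReal (2 * Real.pi) = 1 := by
  have := planarGaussian_eq_radialMass_mul MeasurableSet.univ MeasurableSet.univ (by simp)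
  rw [measure_univ, Set.univ_inter, Real.volume_Ioo] at this
  rw [this]
  ring_nf

lemma radialMass_mul_ofReal (θ : ℝ) :
    radialMass * ENNReal.ofReal θ = ENNReal.ofReal (θ / (2 * Real.pi)) := by
  have h := radialMass_mul_two_pi
  have hpi := Real.pi_pos
  have e : θ = (2 * Real.pi) * (θ / (2 * Real.pi)) := by field_simp
  conv_lhs => rw [e]
  rw [ENNReal.ofReal_mul (by positivity), ← mul_assoc, h, one_mul]

lemma cos_sub_sign {θ φ : ℝ} (h0 : 0 ≤ θ) (hpi : θ ≤ Real.pi)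
    (hφ : φ ∈ Set.Icc (-(Real.pi / 2)) (Real.pi / 2)) :
    (φ < θ - Real.pi / 2 → -(Real.pi / 2) < φ → Real.cos (φ - θ) < 0) ∧
      (θ - Real.pi / 2 < φ → φ < Real.pi / 2 → 0 < Real.cos (φ - θ)) := by
  obtain ⟨h1, h2⟩ := hφ
  refine ⟨fun h h' => ?_, fun h _ => Real.cos_pos_of_mem_Ioo ⟨by linarith, by linarith⟩⟩
  rw [← Real.cos_neg]
  exact Real.cos_neg_of_pi_div_two_lt_of_lt (by linarith) (by linarith)

/-- Squeezing `D` between the open and the closed wedge covers every convention on the boundary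
rays, which are null. -/
lemma planarGaussian_wedge {θ : ℝ} (h0 : 0 ≤ θ) (hpi : θ ≤ Real.pi) {D : Set (ℝ × ℝ)}
    (hD : MeasurableSet D)
    (hin : ∀ p : ℝ × ℝ, 0 < p.1 → p.1 * Real.cos θ + p.2 * Real.sin θ < 0 → p ∈ D)
    (hout : ∀ p ∈ D, 0 ≤ p.1 ∧ p.1 * Real.cos θ + p.2 * Real.sin θ ≤ 0)
    (hcone : ∀ p : ℝ × ℝ, ∀ r > 0, (r * p.1, r * p.2) ∈ D ↔ p ∈ D) :
    planarGaussian D = ENNReal.ofReal (θ / (2 * Real.pi)) := by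
  have hpp := Real.pi_pos
  let J : Set ℝ := {φ | (Real.cos φ, Real.sin φ) ∈ D}
  have hJ : MeasurableSet J := hD.preimage (by fun_prop)
  rw [planarGaussian_eq_radialMass_mul hD hJ
    (fun r hr φ _ => hcone (Real.cos φ, Real.sin φ) r hr)]
  have hcs : ∀ φ, Real.cos φ * Real.cos θ + Real.sin φ * Real.sin θ = Real.cos (φ - θ) :=
    fun φ => (Real.cos_sub φ θ).symm
  have hsub1 : Set.Ioo (-(Real.pi / 2)) (θ - Real.pi / 2) ⊆ J ∩ Set.Ioo (-Real.pi) Real.pi := by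
    rintro φ ⟨h1, h2⟩
    refine ⟨hin _ (Real.cos_pos_of_mem_Ioo ⟨h1, by linarith⟩) ?_, by linarith, by linarith⟩
    simp only [hcs]
    exact (cos_sub_sign h0 hpi ⟨h1.le, by linarith⟩).1 h2 h1
  -- The point `π / 2` is added because for `θ = 0` it satisfies both weak inequalities without
  -- lying in the interval.
  have hsub2 : J ∩ Set.Ioo (-Real.pi) Real.pi ⊆
      insert (Real.pi / 2) (Set.Icc (-(Real.pi / 2)) (θ - Real.pi / 2)) := by
    rintro φ ⟨hφ, h1, h2⟩
    obtain ⟨hc, hc2⟩ := hout _ hφ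
    simp only [hcs] at hc hc2
    have h3 : -(Real.pi / 2) ≤ φ := by
      by_contra! hlt
      have := Real.cos_neg_of_pi_div_two_lt_of_lt (x := -φ) (by linarith) (by linarith)
      rw [Real.cos_neg] at this
      linarith
    have h4 : φ ≤ Real.pi / 2 := by
      by_contra! hlt
      have := Real.cos_neg_of_pi_div_two_lt_of_lt (x := φ) (by linarith) (by linarith)
      linarith
    rcases h4.eq_or_lt with h5 | h5
    · exact Or.inl h5
    refine Or.inr ⟨h3, ?_⟩
    by_contra! hlt
    have := (cos_sub_sign h0 hpi ⟨h3, h4⟩).2 hlt h5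
    linarith
  have hv : volume (J ∩ Set.Ioo (-Real.pi) Real.pi) = ENNReal.ofReal θ := by
    apply le_antisymm
    · refine (measure_mono hsub2).trans (le_of_eq ?_)
      rw [measure_congr (insert_ae_eq_self _ _), Real.volume_Icc]; congr 1; ring
    · refine le_trans (le_of_eq ?_) (measure_mono hsub1)
      rw [Real.volume_Ioo]; congr 1; ring
  rw [hv, radialMass_mul_ofReal]

lemma planarGaussian_map_neg : planarGaussian.map (fun p => -p) = planarGaussian := by
  have h : (gaussianReal 0 1).map (fun x => -x) = gaussianReal 0 1 := by
    rw [gaussianReal_map_neg, neg_zero]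
  have := Measure.map_prod_map (gaussianReal 0 1) (gaussianReal 0 1)
    (f := fun x : ℝ => -x) (g := fun x : ℝ => -x) measurable_neg measurable_neg
  rw [h] at this
  exact this.symm

lemma planarGaussian_sign_ne {θ : ℝ} (h0 : 0 ≤ θ) (hpi : θ ≤ Real.pi) :
    planarGaussian {p | ¬(0 ≤ p.1 ↔ 0 ≤ p.1 * Real.cos θ + p.2 * Real.sin θ)} =
      ENNReal.ofReal (θ / Real.pi) := by
  let L : ℝ × ℝ → ℝ := fun p => p.1 * Real.cos θ + p.2 * Real.sin θ
  have hL : Measurable L := by fun_prop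
  have hLr : ∀ (p : ℝ × ℝ) (r : ℝ), L (r * p.1, r * p.2) = r * L p := by
    intro p r; simp only [L]; ring
  have hLneg : ∀ p, L (-p) = -L p := by intro p; simp only [L, Prod.fst_neg, Prod.snd_neg]; ring
  have hD1 : MeasurableSet {p : ℝ × ℝ | 0 ≤ p.1 ∧ L p < 0} :=
    (measurableSet_le measurable_const measurable_fst).inter (measurableSet_lt hL measurable_const)
  have hD2 : MeasurableSet {p : ℝ × ℝ | p.1 < 0 ∧ 0 ≤ L p} :=
    (measurableSet_lt measurable_fst measurable_const).inter (measurableSet_le measurable_const hL)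
  have hD3 : MeasurableSet {p : ℝ × ℝ | 0 < p.1 ∧ L p ≤ 0} :=
    (measurableSet_lt measurable_const measurable_fst).inter (measurableSet_le hL measurable_const)
  have e : {p : ℝ × ℝ | ¬(0 ≤ p.1 ↔ 0 ≤ p.1 * Real.cos θ + p.2 * Real.sin θ)} =
      {p : ℝ × ℝ | 0 ≤ p.1 ∧ L p < 0} ∪ {p : ℝ × ℝ | p.1 < 0 ∧ 0 ≤ L p} := by
    ext p
    simp only [Set.mem_ofPred_eq, Set.mem_union, L]
    by_cases h : 0 ≤ p.1 <;> by_cases h' : 0 ≤ p.1 * Real.cos θ + p.2 * Real.sin θ <;>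
      simp [h, h'] <;> simp_all
  have m1 : planarGaussian {p : ℝ × ℝ | 0 ≤ p.1 ∧ L p < 0} = ENNReal.ofReal (θ / (2 * Real.pi)) := by
    refine planarGaussian_wedge h0 hpi hD1 (fun p h1 h2 => ⟨h1.le, h2⟩)
      (fun p hp => ⟨hp.1, hp.2.le⟩) fun p r hr => ?_
    simp only [Set.mem_ofPred_eq, hLr]
    rw [mul_nonneg_iff_of_pos_left hr, show r * L p < 0 ↔ L p < 0 from by
      constructor <;> intro h <;> nlinarith]
  have m3 : planarGaussian {p : ℝ × ℝ | 0 < p.1 ∧ L p ≤ 0} = ENNReal.ofReal (θ / (2 * Real.pi)) := by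
    refine planarGaussian_wedge h0 hpi hD3 (fun p h1 h2 => ⟨h1, h2.le⟩)
      (fun p hp => ⟨hp.1.le, hp.2⟩) fun p r hr => ?_
    simp only [Set.mem_ofPred_eq, hLr]
    rw [mul_pos_iff_of_pos_left hr, show r * L p ≤ 0 ↔ L p ≤ 0 from by
      constructor <;> intro h <;> nlinarith]
  -- The antipode of this wedge contains the other boundary ray, so it is compared with the third
  -- wedge and not with the first.
  have m2 : planarGaussian {p : ℝ × ℝ | p.1 < 0 ∧ 0 ≤ L p} = ENNReal.ofReal (θ / (2 * Real.pi)) := by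
    rw [← m3, ← planarGaussian_map_neg, Measure.map_apply measurable_neg hD2, planarGaussian_map_neg]
    congr 1
    ext p
    simp [hLneg]
  rw [e, measure_union _ hD2, m1, m2, ← ENNReal.ofReal_add (by positivity) (by positivity)]
  · congr 1
    have := Real.pi_pos
    field_simp
    ring
  · rw [Set.disjoint_left]
    rintro p ⟨h1, _⟩ ⟨h2, _⟩
    exact absurd h1 (not_le.2 h2)

end PlanarGaussian

/-! ### One- and two-dimensional Gaussian marginals -/

section GaussianMarginals

variable {n : ℕ}

/-- Both laws are centred Gaussian with unit variances and covariance `cos θ`; comparing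
characteristic functions reduces the separation probability to the plane. -/
lemma map_inner_pair_stdGaussian {x y : EuclideanSpace ℝ (Fin n)} (hx : ‖x‖ = 1) (hy : ‖y‖ = 1) :
    (stdGaussian (EuclideanSpace ℝ (Fin n))).map (fun g => (inner ℝ g x, inner ℝ g y)) =
      planarGaussian.map (fun p => (p.1, p.1 * Real.cos (InnerProductGeometry.angle x y) +
        p.2 * Real.sin (InnerProductGeometry.angle x y))) := by
  set θ := InnerProductGeometry.angle x y
  have hc : inner ℝ x y = Real.cos θ := by
    rw [InnerProductGeometry.cos_angle, hx, hy]; simp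
  have i1 : IsProbabilityMeasure ((stdGaussian (EuclideanSpace ℝ (Fin n))).map
    (fun g => (inner ℝ g x, inner ℝ g y))) := Measure.isProbabilityMeasure_map (by fun_prop)
  have i2 : IsProbabilityMeasure (planarGaussian.map (fun p => (p.1, p.1 * Real.cos θ +
        p.2 * Real.sin θ))) := Measure.isProbabilityMeasure_map (by fun_prop)
  refine Measure.ext_of_charFunDual ?_
  ext L
  obtain ⟨s, t, hL⟩ : ∃ s t : ℝ, ∀ a b, L (a, b) = s * a + t * b := by
    refine ⟨L (1, 0), L (0, 1), fun a b => ?_⟩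
    have : ((a, b) : ℝ × ℝ) = a • (1, 0) + b • (0, 1) := by simp
    rw [this, map_add, map_smul, map_smul, smul_eq_mul, smul_eq_mul]; ring
  rw [charFunDual_apply, charFunDual_apply, integral_map (by fun_prop) (by fun_prop),
    integral_map (by fun_prop) (by fun_prop)]
  simp only [hL]
  have h1 := charFun_stdGaussian (s • x + t • y)
  rw [charFun_apply] at h1
  simp only [inner_add_right, inner_smul_right] at h1
  rw [h1, planarGaussian]
  have h2 : ∀ p : ℝ × ℝ, Complex.exp (((s * p.1 + t * (p.1 * Real.cos θ + p.2 * Real.sin θ) : ℝ) : ℂ) *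
      Complex.I) = Complex.exp (((s + t * Real.cos θ : ℝ) : ℂ) * p.1 * Complex.I) *
        Complex.exp (((t * Real.sin θ : ℝ) : ℂ) * p.2 * Complex.I) := by
    intro p
    rw [← Complex.exp_add]
    congr 1
    push_cast
    ring
  simp only [h2]
  rw [integral_prod_mul (f := fun a : ℝ => Complex.exp (((s + t * Real.cos θ : ℝ) : ℂ) * a * Complex.I))
    (g := fun b : ℝ => Complex.exp (((t * Real.sin θ : ℝ) : ℂ) * b * Complex.I)),
    ← charFun_apply_real, ← charFun_apply_real, charFun_gaussianReal, charFun_gaussianReal,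
    ← Complex.exp_add, ← Complex.ofReal_pow, norm_add_sq_real, norm_smul, norm_smul, hx, hy,
    inner_smul_left, inner_smul_right, hc]
  congr 1
  have := Real.sin_sq_add_cos_sq θ
  simp only [mul_one, Real.norm_eq_abs, sq_abs, conj_trivial]
  norm_cast
  push_cast
  have h3 : (Real.sin θ : ℝ) ^ 2 = 1 - Real.cos θ ^ 2 := by linarith
  norm_num
  norm_cast
  rw [mul_pow, h3]
  push_cast
  ring

lemma stdGaussian_sign_ne {x y : EuclideanSpace ℝ (Fin n)} (hx : ‖x‖ = 1) (hy : ‖y‖ = 1) :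
    stdGaussian (EuclideanSpace ℝ (Fin n)) {g | ¬(0 ≤ inner ℝ g x ↔ 0 ≤ inner ℝ g y)} =
      ENNReal.ofReal (ang x y) := by
  have hm : MeasurableSet {p : ℝ × ℝ | ¬(0 ≤ p.1 ↔ 0 ≤ p.2)} := by
    refine MeasurableSet.compl ?_
    exact MeasurableSet.iff (measurableSet_le measurable_const measurable_fst)
      (measurableSet_le measurable_const measurable_snd)
  have h := congrArg (fun μ => μ {p : ℝ × ℝ | ¬(0 ≤ p.1 ↔ 0 ≤ p.2)})
    (map_inner_pair_stdGaussian hx hy)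
  simp only at h
  rw [Measure.map_apply (by fun_prop) hm, Measure.map_apply (by fun_prop) hm] at h
  rw [ang, ← planarGaussian_sign_ne (InnerProductGeometry.angle_nonneg x y)
    (InnerProductGeometry.angle_le_pi x y)]
  exact h

/-- The density is at most `1 / √(2π) ≤ 1/2` and the interval has length `2β`. -/
lemma stdGaussian_abs_inner_le {x : EuclideanSpace ℝ (Fin n)} (hx : ‖x‖ = 1) (β : ℝ) :
    stdGaussian (EuclideanSpace ℝ (Fin n)) {g | |inner ℝ g x| ≤ β} ≤ ENNReal.ofReal β := by
  have h := map_inner_stdGaussian x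
  have hn : ‖x‖₊ = 1 := by ext; simpa using hx
  rw [hn, one_pow] at h
  have h2 : stdGaussian (EuclideanSpace ℝ (Fin n)) {g | |inner ℝ g x| ≤ β} =
      gaussianReal 0 1 (Set.Icc (-β) β) := by
    rw [← h, Measure.map_apply (by fun_prop) measurableSet_Icc]
    congr 1
    ext g
    simp [abs_le]
  rw [h2, gaussianReal_apply _ one_ne_zero]
  calc _ ≤ ∫⁻ _ in Set.Icc (-β) β, ENNReal.ofReal (1 / 2) := by
        refine lintegral_mono fun z => ENNReal.ofReal_le_ofReal ?_
        simp only [gaussianPDFReal, NNReal.coe_one, mul_one, sub_zero]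
        have h1 : Real.exp (-z ^ 2 / 2) ≤ 1 := by
          rw [Real.exp_le_one_iff]; nlinarith [sq_nonneg z]
        have h2 : 2 ≤ √(2 * Real.pi) := by
          apply Real.le_sqrt_of_sq_le
          nlinarith [Real.pi_gt_three]
        calc (√(2 * Real.pi))⁻¹ * Real.exp (-z ^ 2 / 2) ≤ (2 : ℝ)⁻¹ * 1 := by gcongr
          _ = _ := by norm_num
    _ = ENNReal.ofReal β := by
        rw [setLIntegral_const, Real.volume_Icc, ← ENNReal.ofReal_mul (by norm_num)]
        congr 1; ring

end GaussianMarginals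

/-! ### Tail bounds for binomial counts -/

section Counting

variable {α : Type*} {m : ℕ}

open Classical in
/-- The number of coordinates that lie in `B`. -/
noncomputable def countIn (B : Set α) (a : Fin m → α) : ℕ :=
  (Finset.univ.filter fun i => a i ∈ B).card

lemma countIn_eq_sum (B : Set α) (a : Fin m → α) :
    (countIn B a : ℝ) = ∑ i, B.indicator (1 : α → ℝ) (a i) := by
  classical
  rw [countIn, Finset.card_filter]
  push_cast
  exact Finset.sum_congr rfl fun i _ => by simp [Set.indicator_apply]

lemma countIn_le (B : Set α) (a : Fin m → α) : countIn B a ≤ m := by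
  classical
  exact (Finset.card_filter_le _ _).trans (by simp)

lemma countIn_mono {B C : Set α} (h : B ⊆ C) (a : Fin m → α) : countIn B a ≤ countIn C a := by
  classical
  exact Finset.card_le_card (Finset.monotone_filter_right _ fun i _ hi => h hi)

lemma countIn_union_le (B C : Set α) (a : Fin m → α) :
    countIn (B ∪ C) a ≤ countIn B a + countIn C a := by
  classical
  unfold countIn
  simp only [Set.mem_union]
  rw [Finset.filter_or]
  exact Finset.card_union_le _ _

lemma countIn_compl (B : Set α) (a : Fin m → α) : (countIn Bᶜ a : ℝ) = m - countIn B a := by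
  rw [countIn_eq_sum, countIn_eq_sum, Set.indicator_compl]
  simp

variable [MeasurableSpace α] {ν : Measure α} [IsProbabilityMeasure ν]

lemma measurable_countIn {B : Set α} (hB : MeasurableSet B) :
    Measurable fun a : Fin m → α => (countIn B a : ℝ) := by
  simp only [countIn_eq_sum]
  exact Finset.measurable_sum _ fun i _ => (measurable_one.indicator hB).comp (measurable_pi_apply i)

lemma integral_exp_mul_countIn {B : Set α} (hB : MeasurableSet B) (t : ℝ) :
    ∫ a : Fin m → α, Real.exp (t * countIn B a) ∂(Measure.pi fun _ => ν) =
      (1 + (Real.exp t - 1) * ν.real B) ^ m := by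
  have e : ∀ a : Fin m → α, Real.exp (t * countIn B a) =
      ∏ i, (1 + B.indicator (fun _ => Real.exp t - 1) (a i)) := by
    intro a
    rw [countIn_eq_sum, Finset.mul_sum, Real.exp_sum]
    refine Finset.prod_congr rfl fun i _ => ?_
    by_cases h : a i ∈ B <;> simp [h]
  simp only [e]
  rw [integral_fintype_prod_eq_prod (𝕜 := ℝ)
    (fun (_ : Fin m) x => 1 + B.indicator (fun _ => Real.exp t - 1) x)]
  rw [integral_add (integrable_const _) ((integrable_const _).indicator hB),
    integral_indicator_const _ hB]
  simp [mul_comm]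

lemma integrable_exp_mul_countIn {B : Set α} (hB : MeasurableSet B) (t : ℝ) :
    Integrable (fun a : Fin m → α => Real.exp (t * countIn B a)) (Measure.pi fun _ => ν) := by
  have := measurable_countIn (m := m) hB
  refine Integrable.of_bound (this.const_mul t).exp.aestronglyMeasurable (Real.exp (|t| * m)) (ae_of_all _ fun a => ?_)
  rw [Real.norm_eq_abs, Real.abs_exp, Real.exp_le_exp]
  calc t * (countIn B a : ℝ) ≤ |t| * countIn B a := by gcongr; exact le_abs_self t
    _ ≤ |t| * m := by gcongr; exact countIn_le B a

lemma integral_exp_mul_countIn_le {B : Set α} (hB : MeasurableSet B) (t : ℝ) :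
    ∫ a : Fin m → α, Real.exp (t * countIn B a) ∂(Measure.pi fun _ => ν) ≤
      Real.exp ((Real.exp t - 1) * ν.real B * m) := by
  rw [integral_exp_mul_countIn hB, mul_comm _ (m : ℝ), Real.exp_nat_mul]
  have h1 : ν.real B ≤ 1 := measureReal_le_one
  have h0 : 0 ≤ ν.real B := measureReal_nonneg
  gcongr
  · nlinarith [Real.exp_pos t]
  · rw [add_comm]; exact Real.add_one_le_exp _

/-- Chernoff bound for the upper tail of a binomial variable. -/
lemma measure_le_countIn_le {B : Set α} (hB : MeasurableSet B) {p : ℝ} (hp : ν B ≤ ENNReal.ofReal p)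
    (hp0 : 0 ≤ p) (r : ℝ) :
    (Measure.pi fun _ : Fin m => ν) {a | r ≤ countIn B a} ≤
      ENNReal.ofReal (Real.exp (2 * p * m - r)) := by
  have h1 := measure_ge_le_exp_mul_mgf (μ := Measure.pi fun _ : Fin m => ν)
    (X := fun a => (countIn B a : ℝ)) r (t := 1) zero_le_one (integrable_exp_mul_countIn hB 1)
  rw [ENNReal.le_ofReal_iff_toReal_le (measure_ne_top _ _) (Real.exp_pos _).le]
  refine h1.trans ((mul_le_mul_of_nonneg_left (integral_exp_mul_countIn_le hB 1)
    (Real.exp_pos _).le).trans ?_)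
  rw [← Real.exp_add, Real.exp_le_exp]
  have h2 : ν.real B ≤ p := ENNReal.toReal_le_of_le_ofReal hp0 hp
  have h3 : Real.exp 1 - 1 ≤ 2 := by linarith [Real.exp_one_lt_three]
  have : (Real.exp 1 - 1) * ν.real B * m ≤ 2 * p * m := by
    gcongr
  linarith

/-- Chernoff bound for the lower tail of a binomial variable. -/
lemma measure_countIn_le_le {B : Set α} (hB : MeasurableSet B) {p : ℝ} (hp : ENNReal.ofReal p ≤ ν B)
    (r : ℝ) :
    (Measure.pi fun _ : Fin m => ν) {a | countIn B a ≤ r} ≤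
      ENNReal.ofReal (Real.exp (r - p * m / 2)) := by
  have h1 := measure_le_le_exp_mul_mgf (μ := Measure.pi fun _ : Fin m => ν)
    (X := fun a => (countIn B a : ℝ)) r (t := -1) (by norm_num) (integrable_exp_mul_countIn hB (-1))
  rw [ENNReal.le_ofReal_iff_toReal_le (measure_ne_top _ _) (Real.exp_pos _).le]
  refine h1.trans ((mul_le_mul_of_nonneg_left (integral_exp_mul_countIn_le hB (-1))
    (Real.exp_pos _).le).trans ?_)
  rw [← Real.exp_add, Real.exp_le_exp]
  have h2 : p ≤ ν.real B := (ENNReal.ofReal_le_iff_le_toReal (measure_ne_top _ _)).1 hp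
  have h3 : 1 / 2 ≤ 1 - Real.exp (-1) := by
    have : Real.exp (-1) ≤ 1 / 2 := by
      rw [Real.exp_neg, one_div]
      have := Real.add_one_le_exp (1 : ℝ)
      gcongr
      linarith
    linarith
  have h0 : 0 ≤ ν.real B := measureReal_nonneg
  have : p * m / 2 ≤ (1 - Real.exp (-1)) * ν.real B * m := by
    calc p * m / 2 ≤ ν.real B * m / 2 := by gcongr
      _ = 1 / 2 * ν.real B * m := by ring
      _ ≤ _ := by gcongr
  linarith

/-- An indicator has a sub-Gaussian moment generating function with variance proxy `1/4`, by
Hoeffding's lemma. -/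
lemma measure_add_le_countIn_le {B : Set α} (hB : MeasurableSet B) {u : ℝ} (hu : 0 ≤ u) :
    (Measure.pi fun _ : Fin m => ν) {a | ν.real B * m + u * m ≤ countIn B a} ≤
      ENNReal.ofReal (Real.exp (-(2 * u ^ 2 * m))) := by
  rcases Nat.eq_zero_or_pos m with rfl | hm
  · simp
  have hX : Measurable (B.indicator (1 : α → ℝ)) := measurable_one.indicator hB
  have hind : iIndepFun (fun (i : Fin m) (a : Fin m → α) => B.indicator (1 : α → ℝ) (a i) - ν.real B)
      (Measure.pi fun _ => ν) := by
    refine iIndepFun_pi (X := fun (_ : Fin m) x => B.indicator (1 : α → ℝ) x - ν.real B) fun i => ?_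
    fun_prop
  have hsub : ∀ i : Fin m, HasSubgaussianMGF
      (fun a : Fin m → α => B.indicator (1 : α → ℝ) (a i) - ν.real B) ((‖(1 : ℝ) - 0‖₊ / 2) ^ 2)
      (Measure.pi fun _ => ν) := by
    intro i
    have h := hasSubgaussianMGF_of_mem_Icc (μ := Measure.pi fun _ : Fin m => ν)
      (X := fun a : Fin m → α => B.indicator (1 : α → ℝ) (a i)) (a := 0) (b := 1)
      (hX.comp (measurable_pi_apply i)).aemeasurable (ae_of_all _ fun a => by by_cases h : a i ∈ B <;> simp [h])
    have e : ∫ a : Fin m → α, B.indicator (1 : α → ℝ) (a i) ∂(Measure.pi fun _ => ν) = ν.real B := by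
      rw [integral_comp_eval (μ := fun _ : Fin m => ν) (i := i) hX.aestronglyMeasurable,
        integral_indicator_one hB]
    rwa [e] at h
  have h1 := HasSubgaussianMGF.measure_sum_ge_le_of_iIndepFun hind (s := Finset.univ)
    (fun i _ => hsub i) (ε := u * m) (by positivity)
  rw [ENNReal.le_ofReal_iff_toReal_le (measure_ne_top _ _) (Real.exp_pos _).le]
  have e1 : {a : Fin m → α | ν.real B * m + u * m ≤ countIn B a} =
      {a | u * m ≤ ∑ i, (B.indicator (1 : α → ℝ) (a i) - ν.real B)} := by
    ext a
    simp only [Set.mem_ofPred_eq, Finset.sum_sub_distrib, ← countIn_eq_sum, Finset.sum_const,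
      Finset.card_univ, Fintype.card_fin, nsmul_eq_mul]
    constructor <;> intro h <;> linarith
  rw [e1]
  refine h1.trans (Real.exp_le_exp.2 (le_of_eq ?_))
  simp
  field_simp

/-- Hoeffding's inequality for a binomial variable. -/
lemma measure_abs_countIn_sub_le {B : Set α} (hB : MeasurableSet B) {u : ℝ} (hu : 0 ≤ u) :
    (Measure.pi fun _ : Fin m => ν) {a | u * m ≤ |countIn B a - ν.real B * m|} ≤
      ENNReal.ofReal (2 * Real.exp (-(2 * u ^ 2 * m))) := by
  have hsub : {a : Fin m → α | u * m ≤ |countIn B a - ν.real B * m|} ⊆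
      {a | ν.real B * m + u * m ≤ countIn B a} ∪ {a | ν.real Bᶜ * m + u * m ≤ countIn Bᶜ a} := by
    intro a ha
    rcases le_abs.1 (show u * m ≤ |countIn B a - ν.real B * m| from ha) with h | h
    · left; simp only [Set.mem_ofPred_eq]; linarith
    · right
      simp only [Set.mem_ofPred_eq]
      rw [countIn_compl, probReal_compl_eq_one_sub hB]
      linarith
  refine (measure_mono hsub).trans ((measure_union_le _ _).trans ?_)
  rw [two_mul, ENNReal.ofReal_add (Real.exp_pos _).le (Real.exp_pos _).le]
  exact add_le_add (measure_add_le_countIn_le hB hu) (measure_add_le_countIn_le hB.compl hu)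

end Counting

/-! ### From the random matrix to independent Gaussian rows -/

section GaussianRows

variable {n m : ℕ}

/-- The law of a matrix with independent standard Gaussian rows. -/
noncomputable def gaussianRows (n m : ℕ) : Measure (Fin m → EuclideanSpace ℝ (Fin n)) :=
  Measure.pi fun _ => stdGaussian (EuclideanSpace ℝ (Fin n))

instance : IsProbabilityMeasure (gaussianRows n m) := by unfold gaussianRows; infer_instance

/-- The sign map of the matrix with the given rows. -/
noncomputable def rowSigns (a : Fin m → EuclideanSpace ℝ (Fin n)) (x : EuclideanSpace ℝ (Fin n)) :
    Fin m → Bool := fun i => decide (0 ≤ inner ℝ (a i) x)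

lemma signMap_eq_rowSigns (A : Matrix (Fin m) (Fin n) ℝ) :
    signMap A = rowSigns fun i => WithLp.toLp 2 (A i) := by
  funext x i
  simp [signMap, rowSigns, EuclideanSpace.inner_eq_star_dotProduct, Matrix.mulVec, dotProduct_comm]

lemma map_uncurry_pi {ι κ X : Type*} [Fintype ι] [Fintype κ] [MeasurableSpace X] (ν : Measure X)
    [IsProbabilityMeasure ν] :
    (Measure.pi fun _ : ι => Measure.pi fun _ : κ => ν).map (fun a (p : ι × κ) => a p.1 p.2) =
      Measure.pi fun _ : ι × κ => ν := by
  symm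
  refine Measure.pi_eq fun s hs => ?_
  rw [Measure.map_apply (by fun_prop) (MeasurableSet.univ_pi hs)]
  have e : (fun (a : ι → κ → X) (p : ι × κ) => a p.1 p.2) ⁻¹' Set.univ.pi s =
      Set.univ.pi fun i => Set.univ.pi fun j => s (i, j) := by
    ext a
    simp [Set.mem_pi]
  rw [e, Measure.pi_pi]
  simp only [Measure.pi_pi]
  rw [Fintype.prod_prod_type]

lemma IsStdGaussianMatrix.hasLaw_rows {Ω : Type*} [MeasurableSpace Ω] {P : Measure Ω}
    [IsProbabilityMeasure P] {A : Ω → Matrix (Fin m) (Fin n) ℝ} (hA : IsStdGaussianMatrix P A) :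
    HasLaw (fun ω i => (WithLp.toLp 2 (A ω i) : EuclideanSpace ℝ (Fin n))) (gaussianRows n m) P := by
  obtain ⟨hlaw, hind⟩ := hA
  have hae : ∀ p : Fin m × Fin n, AEMeasurable (fun ω => A ω p.1 p.2) P :=
    fun p => (hlaw p.1 p.2).aemeasurable
  have h1 := iIndepFun.map_fun_eq_pi_map hae hind
  simp only [(hlaw _ _).map_eq] at h1
  have h2 : P.map (fun ω (i : Fin m) (j : Fin n) => A ω i j) =
      Measure.pi fun _ => Measure.pi fun _ => gaussianReal 0 1 := by
    have hc : Measurable fun (b : Fin m × Fin n → ℝ) (i : Fin m) (j : Fin n) => b (i, j) := by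
      fun_prop
    have h3 := congrArg (Measure.map fun (b : Fin m × Fin n → ℝ) i j => b (i, j)) h1
    rw [← map_uncurry_pi, AEMeasurable.map_map_of_aemeasurable hc.aemeasurable
      (aemeasurable_pi_lambda _ hae), Measure.map_map hc (by fun_prop)] at h3
    have e : ((fun (b : Fin m × Fin n → ℝ) (i : Fin m) (j : Fin n) => b (i, j)) ∘
      fun (a : Fin m → Fin n → ℝ) (p : Fin m × Fin n) => a p.1 p.2) = id := rfl
    rw [e, Measure.map_id] at h3
    exact h3
  have hae2 : AEMeasurable (fun ω (i : Fin m) (j : Fin n) => A ω i j) P :=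
    aemeasurable_pi_lambda _ fun i => aemeasurable_pi_lambda _ fun j => hae (i, j)
  have hm : Measurable fun (b : Fin m → Fin n → ℝ) i =>
      (WithLp.toLp 2 (b i) : EuclideanSpace ℝ (Fin n)) := by fun_prop
  refine ⟨hm.comp_aemeasurable hae2, ?_⟩
  have h4 := AEMeasurable.map_map_of_aemeasurable hm.aemeasurable hae2
  rw [h2, Measure.pi_map_pi (fun i => by fun_prop)] at h4
  simp only [map_pi_eq_stdGaussian] at h4
  exact h4.symm

/-- The failure probability of an event that depends on the rows only. -/
lemma IsStdGaussianMatrix.measure_le {Ω : Type*} [MeasurableSpace Ω] {P : Measure Ω}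
    [IsProbabilityMeasure P] {A : Ω → Matrix (Fin m) (Fin n) ℝ} (hA : IsStdGaussianMatrix P A)
    (B : Set (Fin m → EuclideanSpace ℝ (Fin n))) :
    P {ω | (fun i => (WithLp.toLp 2 (A ω i) : EuclideanSpace ℝ (Fin n))) ∈ B} ≤
      gaussianRows n m B := by
  have h := hA.hasLaw_rows
  -- `B` need not be measurable, since `K` is arbitrary; a measurable hull has the same measure.
  rw [← measure_toMeasurable B, ← h.map_eq, Measure.map_apply_of_aemeasurable h.aemeasurable
    (measurableSet_toMeasurable _ _)]
  refine measure_mono fun ω hω => ?_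
  exact subset_toMeasurable _ _ hω

lemma withProbAtLeast_of_measure_le {Ω : Type*} [MeasurableSpace Ω] {P : Measure Ω}
    [IsProbabilityMeasure P] {F : Ω → Prop} {q : ℝ} (hq : 0 ≤ q)
    (h : P {ω | ¬F ω} ≤ ENNReal.ofReal q) : WithProbAtLeast P (1 - q) F := by
  refine ⟨(toMeasurable P {ω | ¬F ω})ᶜ, (measurableSet_toMeasurable _ _).compl, fun ω hω => ?_, ?_⟩
  · by_contra hc
    exact hω (subset_toMeasurable P _ hc)
  · rw [probReal_compl_eq_one_sub (measurableSet_toMeasurable _ _), measureReal_def,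
      measure_toMeasurable]
    have := ENNReal.toReal_le_of_le_ofReal hq h
    linarith

end GaussianRows

/-! ### Translates of symmetric sets -/

section Shift

variable {E : Type*} [NormedAddCommGroup E] [InnerProductSpace ℝ E] [FiniteDimensional ℝ E]
  [MeasurableSpace E] [BorelSpace E]

lemma integrable_exp_inner_stdGaussian (y : E) :
    Integrable (fun x => Real.exp (inner ℝ x y)) (stdGaussian E) := by
  refine (integrable_exp_mul_norm_stdGaussian ‖y‖).mono' (by fun_prop) (ae_of_all _ fun x => ?_)
  rw [Real.norm_eq_abs, Real.abs_exp, Real.exp_le_exp, mul_comm]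
  exact real_inner_le_norm x y

lemma integral_exp_inner_stdGaussian (y : E) :
    ∫ x, Real.exp (inner ℝ x y) ∂(stdGaussian E) = Real.exp (‖y‖ ^ 2 / 2) := by
  have := mgf_inner_stdGaussian y 1
  simpa [mgf] using this

/-- The **Cameron–Martin theorem** for the standard Gaussian measure. -/
theorem stdGaussian_map_add_eq_tilted (y : E) :
    (stdGaussian E).map (fun x => x + y) = (stdGaussian E).tilted (fun x => inner ℝ x y) := by
  have i1 : IsProbabilityMeasure ((stdGaussian E).map (fun x => x + y)) :=
    Measure.isProbabilityMeasure_map (by fun_prop)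
  have i2 : IsProbabilityMeasure ((stdGaussian E).tilted (fun x => inner ℝ x y)) :=
    isProbabilityMeasure_tilted (integrable_exp_inner_stdGaussian y)
  refine Measure.ext_of_charFun ?_
  ext t
  have e1 : ∀ s : ℝ, ∀ x : E,
      Real.exp (s * inner ℝ (x + y) t) = Real.exp (s * inner ℝ y t) * Real.exp (inner ℝ x (s • t)) := by
    intro s x
    rw [← Real.exp_add, inner_add_left, inner_smul_right]; ring_nf
  have hmgf : mgf (fun x => inner ℝ (x + y) t) (stdGaussian E) =
      mgf (fun x => inner ℝ x t) ((stdGaussian E).tilted (fun x => inner ℝ x y)) := by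
    ext s
    rw [mgf, mgf, integral_tilted]
    simp only [e1]
    rw [integral_const_mul, integral_exp_inner_stdGaussian, integral_exp_inner_stdGaussian]
    have e2 : ∀ x : E, (Real.exp (inner ℝ x y) / Real.exp (‖y‖ ^ 2 / 2)) • Real.exp (s * inner ℝ x t) =
        Real.exp (-(‖y‖ ^ 2 / 2)) * Real.exp (inner ℝ x (y + s • t)) := by
      intro x
      rw [smul_eq_mul, ← Real.exp_sub, ← Real.exp_add, ← Real.exp_add, inner_add_right,
        inner_smul_right]
      ring_nf
    simp only [e2]
    rw [integral_const_mul, integral_exp_inner_stdGaussian, ← Real.exp_add, ← Real.exp_add,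
      norm_add_sq_real, inner_smul_right]
    ring_nf
  have hint : integrableExpSet (fun x => inner ℝ (x + y) t) (stdGaussian E) = Set.univ := by
    ext s
    simp only [integrableExpSet, Set.mem_ofPred_eq, Set.mem_univ, iff_true, e1]
    exact (integrable_exp_inner_stdGaussian _).const_mul _
  -- The real moment generating functions agree and are finite everywhere, so analytic continuation
  -- to `I` gives equal characteristic functions.
  have h := eqOn_complexMGF_of_mgf hmgf (x := Complex.I) (by simp [hint])
  rw [charFun_apply, charFun_apply, integral_map (by fun_prop) (by fun_prop)]
  simp only [complexMGF] at h
  simpa only [mul_comm Complex.I] using h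

lemma stdGaussian_map_neg : (stdGaussian E).map (fun x => -x) = stdGaussian E :=
  stdGaussian_map (LinearIsometryEquiv.neg ℝ)

/-- A symmetric set loses at most the factor `exp (-‖y‖² / 2)` of its Gaussian measure under
translation by `y`. -/
lemma exp_mul_stdGaussian_le_shift {V : Set E} (hV : MeasurableSet V) (hsymm : ∀ x, -x ∈ V ↔ x ∈ V)
    (y : E) :
    ENNReal.ofReal (Real.exp (-(‖y‖ ^ 2 / 2))) * stdGaussian E V ≤
      stdGaussian E {x | x + y ∈ V} := by
  set γ := stdGaussian E
  have h1 : γ {x | x + y ∈ V} = ENNReal.ofReal (Real.exp (-(‖y‖ ^ 2 / 2))) *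
      ∫⁻ x in V, ENNReal.ofReal (Real.exp (inner ℝ x y)) ∂γ := by
    have := congrArg (fun μ => μ V) (stdGaussian_map_add_eq_tilted y)
    rw [Measure.map_apply (by fun_prop) hV, tilted_apply' _ _ hV,
      integral_exp_inner_stdGaussian] at this
    rw [← lintegral_const_mul _ (by fun_prop)]
    refine Eq.trans this (lintegral_congr fun x => ?_)
    rw [← ENNReal.ofReal_mul (Real.exp_pos _).le, ← Real.exp_sub, ← Real.exp_add]
    ring_nf
  have h2 : ∫⁻ x in V, ENNReal.ofReal (Real.exp (-inner ℝ x y)) ∂γ =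
      ∫⁻ x in V, ENNReal.ofReal (Real.exp (inner ℝ x y)) ∂γ := by
    rw [← lintegral_indicator hV, ← lintegral_indicator hV]
    conv_rhs => rw [show γ = γ.map (fun x => -x) from stdGaussian_map_neg.symm]
    rw [lintegral_map (Measurable.indicator (by fun_prop) hV) measurable_neg]
    refine lintegral_congr fun x => ?_
    by_cases hx : x ∈ V
    · rw [Set.indicator_of_mem hx, Set.indicator_of_mem ((hsymm x).2 hx), inner_neg_left]
    · rw [Set.indicator_of_notMem hx, Set.indicator_of_notMem (fun h => hx ((hsymm x).1 h))]
  -- By symmetry `exp ⟪x, y⟫` may be averaged with its reflection over `V`, and `e^z + e^{-z} ≥ 2`.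
  have h3 : 2 * γ V ≤ 2 * ∫⁻ x in V, ENNReal.ofReal (Real.exp (inner ℝ x y)) ∂γ := by
    calc 2 * γ V = ∫⁻ _ in V, 2 ∂γ := by rw [setLIntegral_const]
      _ ≤ ∫⁻ x in V, (ENNReal.ofReal (Real.exp (inner ℝ x y)) +
          ENNReal.ofReal (Real.exp (-inner ℝ x y))) ∂γ := by
          refine lintegral_mono fun x => ?_
          rw [← ENNReal.ofReal_add (Real.exp_pos _).le (Real.exp_pos _).le]
          rw [← ENNReal.ofReal_ofNat 2]
          apply ENNReal.ofReal_le_ofReal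
          have a := Real.add_one_le_exp (inner ℝ x y)
          have b := Real.add_one_le_exp (-inner ℝ x y)
          linarith
      _ = _ := by
          rw [lintegral_add_left (by fun_prop), h2, two_mul]
  rw [h1]
  gcongr
  exact (ENNReal.mul_le_mul_iff_right (by norm_num) (by norm_num)).1 h3

end Shift

/-! ### A weak Sudakov minoration -/

section Sudakov

variable {n : ℕ}

lemma localSet_norm_le {K : Set (EuclideanSpace ℝ (Fin n))} {ε : ℝ} :
    ∀ v ∈ localSet K ε, ‖v‖ ≤ ε := by
  rintro v ⟨a, _, b, _, rfl, h⟩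
  exact h

lemma zero_mem_localSet {K : Set (EuclideanSpace ℝ (Fin n))} (hK : K.Nonempty) {ε : ℝ} (hε : 0 ≤ ε) :
    (0 : EuclideanSpace ℝ (Fin n)) ∈ localSet K ε := by
  obtain ⟨a, ha⟩ := hK
  exact ⟨a, ha, a, ha, by simp, by simpa⟩

lemma neg_mem_localSet {K : Set (EuclideanSpace ℝ (Fin n))} {ε : ℝ} {v : EuclideanSpace ℝ (Fin n)}
    (h : v ∈ localSet K ε) : -v ∈ localSet K ε := by
  obtain ⟨a, ha, b, hb, rfl, hab⟩ := h
  exact ⟨b, hb, a, ha, by simp, by rwa [norm_sub_rev]⟩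

lemma gaussianWidth_eq (T : Set (EuclideanSpace ℝ (Fin n))) :
    gaussianWidth T = ∫ x, supInner T x ∂(stdGaussian (EuclideanSpace ℝ (Fin n))) := rfl

lemma gaussianWidth_mono {S T : Set (EuclideanSpace ℝ (Fin n))} {σ : ℝ} (hT : ∀ v ∈ T, ‖v‖ ≤ σ)
    (hne : S.Nonempty) (h : S ⊆ T) : gaussianWidth S ≤ gaussianWidth T :=
  integral_mono (integrable_supInner hne fun v hv => hT v (h hv))
    (integrable_supInner (hne.mono h) hT) fun x => supInner_mono hT hne h x

lemma localSet_mono {K : Set (EuclideanSpace ℝ (Fin n))} {ε ε' : ℝ} (h : ε ≤ ε') :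
    localSet K ε ⊆ localSet K ε' := by
  rintro v ⟨a, ha, b, hb, rfl, hab⟩
  exact ⟨a, ha, b, hb, rfl, hab.trans h⟩

lemma supInner_nonneg {T : Set (EuclideanSpace ℝ (Fin n))} {σ : ℝ} (hT : ∀ v ∈ T, ‖v‖ ≤ σ)
    (h0 : (0 : EuclideanSpace ℝ (Fin n)) ∈ T) (x : EuclideanSpace ℝ (Fin n)) : 0 ≤ supInner T x := by
  simpa using inner_le_supInner hT x h0

lemma gaussianWidth_nonneg {T : Set (EuclideanSpace ℝ (Fin n))} {σ : ℝ} (hT : ∀ v ∈ T, ‖v‖ ≤ σ)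
    (h0 : (0 : EuclideanSpace ℝ (Fin n)) ∈ T) : 0 ≤ gaussianWidth T :=
  integral_nonneg fun x => supInner_nonneg hT h0 x

lemma supInner_add_le {T : Set (EuclideanSpace ℝ (Fin n))} {σ : ℝ} (hne : T.Nonempty)
    (hT : ∀ v ∈ T, ‖v‖ ≤ σ) (x y : EuclideanSpace ℝ (Fin n)) :
    supInner T (x + y) ≤ supInner T x + supInner T y := by
  refine supInner_le hne fun v hv => ?_
  rw [inner_add_left]
  exact add_le_add (inner_le_supInner hT x hv) (inner_le_supInner hT y hv)

lemma supInner_neg {T : Set (EuclideanSpace ℝ (Fin n))} {σ : ℝ} (hne : T.Nonempty)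
    (hT : ∀ v ∈ T, ‖v‖ ≤ σ) (hsymm : ∀ v ∈ T, -v ∈ T) (x : EuclideanSpace ℝ (Fin n)) :
    supInner T (-x) = supInner T x := by
  apply le_antisymm
  · refine supInner_le hne fun v hv => ?_
    rw [inner_neg_left, ← inner_neg_right]
    exact inner_le_supInner hT x (hsymm v hv)
  · refine supInner_le hne fun v hv => ?_
    have := inner_le_supInner hT (-x) (hsymm v hv)
    rwa [inner_neg_neg] at this

/-- The width of a symmetric set that contains two points at distance `r` is at least `r / 8`. -/
lemma norm_sub_div_eight_le_gaussianWidth {T : Set (EuclideanSpace ℝ (Fin n))} {σ : ℝ}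
    (hT : ∀ v ∈ T, ‖v‖ ≤ σ) (hsymm : ∀ v ∈ T, -v ∈ T) {s t : EuclideanSpace ℝ (Fin n)}
    (hs : s ∈ T) (ht : t ∈ T) : ‖s - t‖ / 8 ≤ gaussianWidth T := by
  set γ := stdGaussian (EuclideanSpace ℝ (Fin n))
  have hne : T.Nonempty := ⟨s, hs⟩
  have h1 : ∀ x, |inner ℝ x (s - t)| ≤ 2 * supInner T x := by
    intro x
    have a1 := inner_le_supInner hT x hs
    have a2 := inner_le_supInner hT x ht
    have a3 := inner_le_supInner hT x (hsymm s hs)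
    have a4 := inner_le_supInner hT x (hsymm t ht)
    rw [inner_neg_right] at a3 a4
    rw [inner_sub_right, abs_le]
    constructor <;> linarith
  rcases eq_or_ne (s - t) 0 with h0 | h0
  · rw [h0, norm_zero, zero_div]
    exact integral_nonneg fun x => by
      have := (abs_nonneg _).trans (h1 x)
      simp only [Pi.zero_apply]
      change 0 ≤ supInner T x
      linarith
  set r := ‖s - t‖
  have hr : 0 < r := norm_pos_iff.2 h0
  set u := r⁻¹ • (s - t)
  have hu : ‖u‖ = 1 := by
    rw [norm_smul, norm_inv, norm_norm, inv_mul_cancel₀ hr.ne']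
  have hst : s - t = r • u := by simp [u, smul_smul, hr.ne']
  have hsmall := stdGaussian_abs_inner_le hu (1 / 2)
  have hB : MeasurableSet {g : EuclideanSpace ℝ (Fin n) | |inner ℝ g u| ≤ 1 / 2} :=
    measurableSet_le (by fun_prop) measurable_const
  -- With probability at least `1/2` the marginal exceeds `1/2`, and then the support function is at
  -- least `r / 4`.
  have hbig : 1 / 2 ≤ γ.real {g : EuclideanSpace ℝ (Fin n) | |inner ℝ g u| ≤ 1 / 2}ᶜ := by
    rw [probReal_compl_eq_one_sub hB]
    have := ENNReal.toReal_le_of_le_ofReal (by norm_num) hsmall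
    rw [measureReal_def]
    linarith
  have h2 : ∀ x, ({g : EuclideanSpace ℝ (Fin n) | |inner ℝ g u| ≤ 1 / 2}ᶜ).indicator
      (fun _ => r / 4) x ≤ supInner T x := by
    intro x
    have h3 := h1 x
    rw [hst, inner_smul_right, abs_mul, abs_of_pos hr] at h3
    have h4 : 0 ≤ r * |inner ℝ x u| := by positivity
    by_cases hx : |inner ℝ x u| ≤ 1 / 2
    · rw [Set.indicator_of_notMem (by simpa using hx)]
      linarith
    · rw [Set.indicator_of_mem (by simpa using hx)]
      push Not at hx
      nlinarith
  have h3 := integral_mono (μ := γ) ((integrable_const (r / 4)).indicator hB.compl)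
    (integrable_supInner hne hT) h2
  rw [integral_indicator_const _ hB.compl, smul_eq_mul] at h3
  rw [gaussianWidth_eq]
  refine le_trans ?_ h3
  nlinarith

/-- A weak form of **Sudakov's minoration**: for points of norm at most `R` and mutual distances at
least `r`, with a constant that depends on `r` and `R` but not on the dimension. -/
theorem log_card_le_gaussianWidth_sq {T : Set (EuclideanSpace ℝ (Fin n))} {σ : ℝ}
    (hT : ∀ v ∈ T, ‖v‖ ≤ σ) (hsymm : ∀ v ∈ T, -v ∈ T) {r R : ℝ} (hr : 0 < r)
    (S : Finset (EuclideanSpace ℝ (Fin n))) (hST : ∀ s ∈ S, s ∈ T) (hSR : ∀ s ∈ S, ‖s‖ ≤ R)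
    (hsep : ∀ s ∈ S, ∀ t ∈ S, s ≠ t → r ≤ ‖s - t‖) :
    Real.log S.card ≤ (64 / r ^ 2 + 81 * R ^ 2 / (2 * r ^ 4)) * gaussianWidth T ^ 2 := by
  rcases Nat.lt_or_ge S.card 2 with hcard | hcard
  · have : Real.log S.card = 0 := by
      interval_cases S.card <;> simp
    rw [this]
    positivity
  obtain ⟨s₀, hs₀, t₀, ht₀, hst₀⟩ := Finset.one_lt_card.1 hcard
  have hne : T.Nonempty := ⟨s₀, hST _ hs₀⟩
  set γ := stdGaussian (EuclideanSpace ℝ (Fin n))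
  set ω := gaussianWidth T with hω
  have hωr : r / 8 ≤ ω := by
    have h1 := norm_sub_div_eight_le_gaussianWidth hT hsymm (hST _ hs₀) (hST _ ht₀)
    have h2 := hsep _ hs₀ _ ht₀ hst₀
    linarith
  have hω0 : 0 < ω := by linarith
  have hFn : ∀ x, 0 ≤ supInner T x := by
    intro x
    have h1 := inner_le_supInner hT x (hST _ hs₀)
    have h2 := inner_le_supInner hT x (hsymm _ (hST _ hs₀))
    rw [inner_neg_right] at h2
    linarith
  have hFc := continuous_supInner hne hT
  let V : Set (EuclideanSpace ℝ (Fin n)) := {z | supInner T z ≤ 2 * ω}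
  have hV : MeasurableSet V := measurableSet_le hFc.measurable measurable_const
  have hVsymm : ∀ x, -x ∈ V ↔ x ∈ V := by
    intro x
    simp only [V, Set.mem_ofPred_eq, supInner_neg hne hT hsymm]
  -- Markov's inequality. Disjoint translates of this symmetric set `V` will bound the number of
  -- points of `S`.
  have hVhalf : 1 / 2 ≤ γ.real V := by
    have h1 := mul_meas_ge_le_integral_of_nonneg (μ := γ) (ae_of_all _ hFn)
      (integrable_supInner hne hT) (2 * ω)
    rw [← gaussianWidth_eq, ← hω] at h1
    have h2 : γ.real Vᶜ ≤ γ.real {x | 2 * ω ≤ supInner T x} := by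
      refine measureReal_mono fun x hx => ?_
      simp only [V, Set.mem_compl_iff, Set.mem_ofPred_eq, not_le] at hx
      exact hx.le
    rw [probReal_compl_eq_one_sub hV] at h2
    have h3 : γ.real {x | 2 * ω ≤ supInner T x} ≤ 1 / 2 := by
      have : 2 * ω * γ.real {x | 2 * ω ≤ supInner T x} ≤ 2 * ω * (1 / 2) := by linarith
      exact le_of_mul_le_mul_left this (by linarith)
    linarith
  -- A common point of two translates would give `supInner T (l • (s - t)) ≤ 4ω`, while separation
  -- gives at least `l r² / 2`. The constant `9` makes the latter `4.5 ω`.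
  set l := 9 * ω / r ^ 2 with hl
  have hl0 : 0 < l := by positivity
  let W : EuclideanSpace ℝ (Fin n) → Set (EuclideanSpace ℝ (Fin n)) := fun s => {x | x + l • s ∈ V}
  have hWm : ∀ s, MeasurableSet (W s) := fun s => hV.preimage (by fun_prop)
  have hdisj : Set.PairwiseDisjoint (↑S) W := by
    intro s hs t ht hst
    rw [Function.onFun, Set.disjoint_left]
    intro x hxs hxt
    simp only [W, V, Set.mem_ofPred_eq] at hxs hxt
    have h1 : supInner T (l • (s - t)) ≤ 4 * ω := by
      have e : l • (s - t) = (x + l • s) + -(x + l • t) := by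
        rw [smul_sub]; abel
      rw [e]
      have := supInner_add_le hne hT (x + l • s) (-(x + l • t))
      rw [supInner_neg hne hT hsymm] at this
      linarith
    rw [supInner_smul hl0.le] at h1
    have h2 : r ^ 2 ≤ 2 * supInner T (s - t) := by
      have a1 := inner_le_supInner hT (s - t) (hST s hs)
      have a2 := inner_le_supInner hT (s - t) (hsymm _ (hST t ht))
      rw [inner_neg_right] at a2
      have a3 : inner ℝ (s - t) s - inner ℝ (s - t) t = ‖s - t‖ ^ 2 := by
        rw [← inner_sub_right, real_inner_self_eq_norm_sq]
      have a4 : r ^ 2 ≤ ‖s - t‖ ^ 2 := by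
        have := hsep s hs t ht hst
        gcongr
      linarith
    have h3 : l * r ^ 2 ≤ l * (2 * supInner T (s - t)) := by gcongr
    have h4 : l * r ^ 2 = 9 * ω := by rw [hl]; field_simp
    linarith
  have hR0 : 0 ≤ R := (norm_nonneg _).trans (hSR _ hs₀)
  have hWlow : ∀ s ∈ S, Real.exp (-((l * R) ^ 2 / 2)) * (1 / 2) ≤ γ.real (W s) := by
    intro s hs
    have h1 := exp_mul_stdGaussian_le_shift hV hVsymm (l • s)
    have h2 := ENNReal.toReal_mono (measure_ne_top _ _) h1
    rw [ENNReal.toReal_mul, ENNReal.toReal_ofReal (Real.exp_pos _).le] at h2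
    refine le_trans (mul_le_mul ?_ hVhalf (by norm_num) (Real.exp_pos _).le) h2
    rw [Real.exp_le_exp, norm_smul, Real.norm_eq_abs, abs_of_pos hl0]
    have := hSR s hs
    gcongr
  have hsum : (S.card : ℝ) * (Real.exp (-((l * R) ^ 2 / 2)) * (1 / 2)) ≤ 1 := by
    calc (S.card : ℝ) * (Real.exp (-((l * R) ^ 2 / 2)) * (1 / 2))
        = ∑ _s ∈ S, Real.exp (-((l * R) ^ 2 / 2)) * (1 / 2) := by
          rw [Finset.sum_const, nsmul_eq_mul]
      _ ≤ ∑ s ∈ S, γ.real (W s) := Finset.sum_le_sum hWlow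
      _ = γ.real (⋃ s ∈ S, W s) := (measureReal_biUnion_finset hdisj fun s _ => hWm s).symm
      _ ≤ 1 := measureReal_le_one
  have hcard' : (S.card : ℝ) ≤ Real.exp (1 + (l * R) ^ 2 / 2) := by
    have e : Real.exp (1 + (l * R) ^ 2 / 2) =
        Real.exp 1 * (Real.exp (-((l * R) ^ 2 / 2)))⁻¹ := by
      rw [← Real.exp_neg, ← Real.exp_add, neg_neg]
    rw [e, ← div_eq_mul_inv, le_div_iff₀ (Real.exp_pos _)]
    have := Real.add_one_le_exp (1 : ℝ)
    linarith
  have hcpos : (0 : ℝ) < S.card := by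
    have : 0 < S.card := by omega
    exact_mod_cast this
  have hlog := (Real.log_le_iff_le_exp hcpos).2 hcard'
  refine hlog.trans ?_
  -- The additive constant, left over from the factor `2 ≤ e`, is absorbed through `ω ≥ r / 8`.
  have h1 : 1 ≤ 64 / r ^ 2 * ω ^ 2 := by
    have : r ^ 2 / 64 ≤ ω ^ 2 := by
      calc r ^ 2 / 64 = (r / 8) ^ 2 := by ring
        _ ≤ ω ^ 2 := by gcongr
    rw [div_mul_eq_mul_div, le_div_iff₀ (by positivity)]
    linarith
  have h2 : (l * R) ^ 2 / 2 = 81 * R ^ 2 / (2 * r ^ 4) * ω ^ 2 := by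
    rw [hl]; field_simp; ring
  rw [h2, add_mul]
  linarith

end Sudakov

/-! ### Covering numbers at two radii -/

section Nets

variable {n : ℕ} {K : Set (EuclideanSpace ℝ (Fin n))}

lemma edist_le_toNNReal_iff {E : Type*} [SeminormedAddCommGroup E] {ε : ℝ} (hε : 0 ≤ ε) (x y : E) :
    edist x y ≤ (ε.toNNReal : ENNReal) ↔ ‖x - y‖ ≤ ε := by
  rw [edist_dist, dist_eq_norm]
  exact ENNReal.ofReal_le_ofReal_iff hε

lemma coveringNumber_ne_top_of_subset_sphere (hK : K ⊆ Metric.sphere 0 1) {ε : ℝ} (hε : 0 < ε) :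
    Metric.coveringNumber ε.toNNReal K ≠ ⊤ := by
  have htb : TotallyBounded K := (isCompact_sphere 0 1).totallyBounded.subset hK
  obtain ⟨N, hNK, hNf, hN⟩ := Metric.exists_finite_isCover_of_totallyBounded
    (ε := ε.toNNReal) (by simpa using hε) htb
  exact ne_top_of_le_ne_top (Set.encard_ne_top_iff.2 hNf) (hN.coveringNumber_le_encard hNK)

lemma exists_minimal_net (hK : K ⊆ Metric.sphere 0 1) {ε : ℝ} (hε : 0 < ε) :
    ∃ X : Finset (EuclideanSpace ℝ (Fin n)), (∀ x ∈ X, x ∈ K) ∧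
      (∀ x ∈ K, ∃ x' ∈ X, ‖x - x'‖ ≤ ε) ∧ logCoveringNumber K ε = Real.log X.card := by
  obtain ⟨C, hCK, hCf, hC, hcard⟩ := Metric.exists_set_encard_eq_coveringNumber
    (coveringNumber_ne_top_of_subset_sphere hK hε)
  refine ⟨hCf.toFinset, fun x hx => hCK (by simpa using hx), fun x hx => ?_, ?_⟩
  · obtain ⟨y, hy, hxy⟩ := hC hx
    exact ⟨y, by simpa using hy, (edist_le_toNNReal_iff hε.le x y).1 hxy⟩
  · rw [logCoveringNumber, ← hcard, hCf.encard_eq_coe_toFinset_card]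
    simp

lemma logCoveringNumber_nonneg (K : Set (EuclideanSpace ℝ (Fin n))) (ε : ℝ) :
    0 ≤ logCoveringNumber K ε := Real.log_natCast_nonneg _

lemma logCoveringNumber_le (hK : K ⊆ Metric.sphere 0 1) {r : ℝ} (hr : 0 < r)
    (hne : K.Nonempty) (X : Finset (EuclideanSpace ℝ (Fin n))) (hXK : ∀ x ∈ X, x ∈ K)
    (hX : ∀ x ∈ K, ∃ x' ∈ X, ‖x - x'‖ ≤ r) : logCoveringNumber K r ≤ Real.log X.card := by
  have hcov : Metric.IsCover r.toNNReal K (X : Set (EuclideanSpace ℝ (Fin n))) := by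
    intro x hx
    obtain ⟨y, hy, hxy⟩ := hX x hx
    exact ⟨y, hy, (edist_le_toNNReal_iff hr.le x y).2 hxy⟩
  have h1 := hcov.coveringNumber_le_encard (fun x hx => hXK x hx)
  rw [Set.encard_coe_eq_coe_finsetCard] at h1
  have h2 : (Metric.coveringNumber r.toNNReal K).toNat ≤ X.card := by
    simpa using ENat.toNat_le_toNat h1 (by simp)
  have h3 : 0 < (Metric.coveringNumber r.toNNReal K).toNat := by
    rw [Nat.pos_iff_ne_zero]
    intro h0
    rcases ENat.toNat_eq_zero.1 h0 with h | h
    · exact hne.ne_empty (Metric.coveringNumber_eq_zero.1 h)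
    · exact coveringNumber_ne_top_of_subset_sphere hK hr h
  rw [logCoveringNumber]
  exact Real.log_le_log (by exact_mod_cast h3) (by exact_mod_cast h2)

/-- Refining a net from radius `ε` to radius `r` costs at most a multiple, depending on `r` only, of
the squared width of the local set. -/
theorem logCoveringNumber_le_add (hK : K ⊆ Metric.sphere 0 1) {r ε : ℝ} (hr : 0 < r) (hrε : r ≤ ε) :
    logCoveringNumber K r ≤
      logCoveringNumber K ε + (64 / r ^ 2 + 162 / r ^ 4) * gaussianWidth (localSet K ε) ^ 2 := by
  classical
  rcases K.eq_empty_or_nonempty with rfl | hne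
  · simp [logCoveringNumber]
    positivity
  set B := (64 / r ^ 2 + 162 / r ^ 4) * gaussianWidth (localSet K ε) ^ 2 with hB
  have hε : 0 < ε := hr.trans_le hrε
  obtain ⟨X, hXK, hX, hlog⟩ := exists_minimal_net hK hε
  have hloc : ∀ x ∈ X, ∃ Y : Finset (EuclideanSpace ℝ (Fin n)), (∀ y ∈ Y, y ∈ K) ∧
      (∀ z ∈ K, ‖z - x‖ ≤ ε → ∃ y ∈ Y, ‖z - y‖ ≤ r) ∧ (Y.card : ℝ) ≤ Real.exp B := by
    intro x hx
    set A := {z ∈ K | ‖z - x‖ ≤ ε}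
    -- Finiteness of the packing number follows from a finite cover at radius `r / 2`.
    have hpack : Metric.packingNumber r.toNNReal A ≠ ⊤ := by
      have h1 := Metric.packingNumber_two_mul_le_externalCoveringNumber (r / 2).toNNReal A
      rw [show (2 : NNReal) * (r / 2).toNNReal = r.toNNReal by
        rw [← Real.toNNReal_ofNat, ← Real.toNNReal_mul (by norm_num)]; congr 1; ring] at h1
      refine ne_top_of_le_ne_top ?_ h1
      refine ne_top_of_le_ne_top ?_ (Metric.externalCoveringNumber_le_coveringNumber _ _)
      exact coveringNumber_ne_top_of_subset_sphere ((Set.sep_subset _ _).trans hK) (by positivity)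
    obtain hcov := Metric.isCover_maximalSeparatedSet hpack
    have hsub : Metric.maximalSeparatedSet r.toNNReal A ⊆ A := Metric.maximalSeparatedSet_subset
    have hsep : Metric.IsSeparated (r.toNNReal : ENNReal) (Metric.maximalSeparatedSet r.toNNReal A) :=
      Metric.isSeparated_maximalSeparatedSet
    have hfin : (Metric.maximalSeparatedSet r.toNNReal A).Finite := by
      rw [← Set.encard_ne_top_iff, Metric.encard_maximalSeparatedSet hpack]
      exact hpack
    refine ⟨hfin.toFinset, fun y hy => (hsub (by simpa using hy)).1, fun z hz hzx => ?_, ?_⟩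
    · obtain ⟨y, hy, hzy⟩ := hcov (show z ∈ A from ⟨hz, hzx⟩)
      exact ⟨y, by simpa using hy, (edist_le_toNNReal_iff hr.le z y).1 hzy⟩
    · set Y := hfin.toFinset with hY
      have hYA : ∀ y ∈ Y, y ∈ K ∧ ‖y - x‖ ≤ ε := fun y hy => hsub (by simpa [hY] using hy)
      let S := Y.image fun y => y - x
      have hScard : S.card = Y.card := Finset.card_image_of_injective _ sub_left_injective
      have hnorm : ∀ y ∈ K, ‖y‖ = 1 := fun y hy => by simpa using hK hy
      -- The differences lie in the local set at radius `ε`, but their norms are bounded by `2`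
      -- since `K` lies on the sphere. Using `R = 2` instead of `ε` keeps the constant independent
      -- of `ε`.
      have hmain := log_card_le_gaussianWidth_sq (T := localSet K ε) localSet_norm_le
        (fun v hv => neg_mem_localSet hv) hr (R := 2) S
        (by
          intro s hs
          obtain ⟨y, hy, rfl⟩ := Finset.mem_image.1 hs
          exact ⟨y, (hYA y hy).1, x, hXK x hx, rfl, (hYA y hy).2⟩)
        (by
          intro s hs
          obtain ⟨y, hy, rfl⟩ := Finset.mem_image.1 hs
          have := norm_sub_le y x
          rw [hnorm y (hYA y hy).1, hnorm x (hXK x hx)] at this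
          linarith)
        (by
          intro s hs t ht hst
          obtain ⟨y, hy, rfl⟩ := Finset.mem_image.1 hs
          obtain ⟨z, hz, rfl⟩ := Finset.mem_image.1 ht
          rw [sub_sub_sub_cancel_right]
          have hyz : y ≠ z := fun h => hst (by rw [h])
          have h1 := hsep (by simpa [hY] using hy) (by simpa [hY] using hz) hyz
          by_contra! hlt
          exact absurd ((edist_le_toNNReal_iff hr.le y z).2 hlt.le) (not_le.2 h1))
      rw [hScard] at hmain
      have hB' : Real.log Y.card ≤ B := by
        refine hmain.trans (le_of_eq ?_)
        rw [hB]; ring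
      rcases Nat.eq_zero_or_pos Y.card with h0 | h0
      · rw [h0]; simpa using (Real.exp_pos B).le
      · exact (Real.log_le_iff_le_exp (by exact_mod_cast h0)).1 hB'
  choose! Y hYK hYcov hYcard using hloc
  have hcovU := logCoveringNumber_le hK hr hne (X.biUnion Y)
    (fun y hy => by
      obtain ⟨x, hx, hyx⟩ := Finset.mem_biUnion.1 hy
      exact hYK x hx y hyx)
    (fun z hz => by
      obtain ⟨x, hx, hzx⟩ := hX z hz
      obtain ⟨y, hy, hzy⟩ := hYcov x hx z hz hzx
      exact ⟨y, Finset.mem_biUnion.2 ⟨x, hx, hy⟩, hzy⟩)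
  refine hcovU.trans ?_
  have hXpos : 0 < X.card := by
    obtain ⟨z, hz⟩ := hne
    obtain ⟨x, hx, _⟩ := hX z hz
    exact Finset.card_pos.2 ⟨x, hx⟩
  have hXpos' : (0 : ℝ) < X.card := by exact_mod_cast hXpos
  have hUcard : ((X.biUnion Y).card : ℝ) ≤ X.card * Real.exp B := by
    calc ((X.biUnion Y).card : ℝ) ≤ ∑ x ∈ X, ((Y x).card : ℝ) := by
          exact_mod_cast Finset.card_biUnion_le
      _ ≤ ∑ _x ∈ X, Real.exp B := Finset.sum_le_sum hYcard
      _ = _ := by rw [Finset.sum_const, nsmul_eq_mul]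
  rcases Nat.eq_zero_or_pos (X.biUnion Y).card with h0 | h0
  · rw [h0, Nat.cast_zero, Real.log_zero]
    have := logCoveringNumber_nonneg K ε
    positivity
  · calc Real.log (X.biUnion Y).card ≤ Real.log (X.card * Real.exp B) :=
          Real.log_le_log (by exact_mod_cast h0) hUcard
      _ = logCoveringNumber K ε + B := by
          rw [Real.log_mul hXpos'.ne' (Real.exp_pos _).ne', Real.log_exp, hlog]

end Nets

/-! ### Uniform control of large inner products by signed sums -/

section SignedSums

variable {n m : ℕ}

/-- The number of nonzero signs. -/
def signWeight (s : Fin m → SignType) : ℝ := ∑ i, ((s i : ℝ)) ^ 2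

lemma signWeight_nonneg (s : Fin m → SignType) : 0 ≤ signWeight s :=
  Finset.sum_nonneg fun _ _ => sq_nonneg _

lemma measurable_sum_smul (c : Fin m → ℝ) :
    Measurable fun a : Fin m → EuclideanSpace ℝ (Fin n) => ∑ i, c i • a i := by
  fun_prop

lemma map_signed_sum_gaussianRows (s : Fin m → SignType) :
    (gaussianRows n m).map (fun a => ∑ i, (s i : ℝ) • a i) =
      (stdGaussian (EuclideanSpace ℝ (Fin n))).map (fun x => √(signWeight s) • x) := by
  have i1 : IsProbabilityMeasure ((gaussianRows n m).map (fun a => ∑ i, (s i : ℝ) • a i)) :=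
    Measure.isProbabilityMeasure_map (measurable_sum_smul _).aemeasurable
  have i2 : IsProbabilityMeasure ((stdGaussian (EuclideanSpace ℝ (Fin n))).map
    (fun x => √(signWeight s) • x)) := Measure.isProbabilityMeasure_map (by fun_prop)
  refine Measure.ext_of_charFun ?_
  ext t
  rw [charFun_map_smul, charFun_stdGaussian, charFun_apply,
    integral_map (measurable_sum_smul _).aemeasurable (by fun_prop), gaussianRows]
  have e : ∀ a : Fin m → EuclideanSpace ℝ (Fin n),
      Complex.exp ((inner ℝ (∑ i, (s i : ℝ) • a i) t : ℝ) * Complex.I) =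
        ∏ i, Complex.exp ((inner ℝ (a i) ((s i : ℝ) • t) : ℝ) * Complex.I) := by
    intro a
    rw [← Complex.exp_sum, ← Finset.sum_mul, sum_inner]
    push_cast
    simp only [inner_smul_left, inner_smul_right, conj_trivial]
  simp only [e]
  rw [integral_fintype_prod_eq_prod (𝕜 := ℂ) (fun (i : Fin m) x =>
    Complex.exp ((inner ℝ x ((s i : ℝ) • t) : ℝ) * Complex.I))]
  simp only [← charFun_apply, charFun_stdGaussian]
  rw [← Complex.exp_sum]
  congr 1
  have h : ∀ c : ℝ, ‖c • t‖ ^ 2 = c ^ 2 * ‖t‖ ^ 2 := by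
    intro c; rw [norm_smul, mul_pow, Real.norm_eq_abs, sq_abs]
  simp only [← Complex.ofReal_pow, h, Real.sq_sqrt (signWeight_nonneg s)]
  rw [signWeight, ← Finset.sum_div, Finset.sum_neg_distrib, Finset.sum_mul]
  push_cast
  rfl

/-- The sum factorizes over coordinates into `(1 + 2 e^{-D})^m`. This is the entropy cost of
choosing a set of rows and their signs. -/
lemma sum_exp_neg_signWeight_le (D : ℝ) :
    ∑ s : Fin m → SignType, Real.exp (-(D * signWeight s)) ≤ Real.exp (2 * Real.exp (-D) * m) := by
  have h := Fintype.sum_pow (fun j : SignType => Real.exp (-(D * (j : ℝ) ^ 2))) m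
  have e : ∀ s : Fin m → SignType,
      ∏ i, Real.exp (-(D * (s i : ℝ) ^ 2)) = Real.exp (-(D * signWeight s)) := by
    intro s
    rw [← Real.exp_sum, signWeight, Finset.mul_sum, Finset.sum_neg_distrib]
  simp only [e] at h
  rw [← h]
  have h2 : ∑ j : SignType, Real.exp (-(D * (j : ℝ) ^ 2)) = 2 * Real.exp (-D) + 1 := by
    have : (Finset.univ : Finset SignType) = {0, -1, 1} := rfl
    rw [this]
    simp
    ring
  rw [h2, mul_comm _ (m : ℝ), Real.exp_nat_mul]
  gcongr
  exact Real.add_one_le_exp _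

/-- The signed sum is `√w` times a standard Gaussian vector, so the event says that the support
function reaches `β √w`. The mean is at most half of this, and concentration applies to the other
half. -/
lemma measure_signed_sum_le {T : Set (EuclideanSpace ℝ (Fin n))} (hne : T.Nonempty) {σ β k : ℝ}
    (hσ : 0 < σ) (hT : ∀ v ∈ T, ‖v‖ ≤ σ) (hβ : 0 < β) (hk : 0 < k)
    (hω : 2 * gaussianWidth T ≤ β * √k) (s : Fin m → SignType) (hs : k ≤ signWeight s) :
    gaussianRows n m {a | β * signWeight s ≤ supInner T (∑ i, (s i : ℝ) • a i)} ≤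
      ENNReal.ofReal (Real.exp (-(2 * (β ^ 2 / (4 * Real.pi ^ 2 * σ ^ 2)) * signWeight s))) := by
  set w := signWeight s
  have hw : 0 < w := hk.trans_le hs
  have hFm := (continuous_supInner hne hT).measurable
  have hsw : √k ≤ √w := Real.sqrt_le_sqrt hs
  have hsw0 : 0 < √w := Real.sqrt_pos.2 hw
  have hww : √w * √w = w := Real.mul_self_sqrt hw.le
  have hm : MeasurableSet {z : EuclideanSpace ℝ (Fin n) | β * w ≤ supInner T z} :=
    measurableSet_le measurable_const hFm
  have h1 := congrArg (fun μ => μ {z : EuclideanSpace ℝ (Fin n) | β * w ≤ supInner T z})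
    (map_signed_sum_gaussianRows (n := n) s)
  simp only [] at h1
  rw [Measure.map_apply (measurable_sum_smul _) hm, Measure.map_apply (by fun_prop) hm] at h1
  have h2 : gaussianRows n m {a | β * w ≤ supInner T (∑ i, (s i : ℝ) • a i)} =
      stdGaussian (EuclideanSpace ℝ (Fin n)) {x | β * w ≤ supInner T (√w • x)} := h1
  have hu : 0 ≤ β * √w / 2 := by positivity
  have h3 := measure_supInner_ge_le hne hσ hT hu
  rw [h2]
  refine (measure_mono fun x hx => ?_).trans (h3.trans (ENNReal.ofReal_le_ofReal ?_))
  · simp only [Set.mem_ofPred_eq, supInner_smul hsw0.le] at hx ⊢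
    rw [← gaussianWidth_eq]
    have h4 : β * √w ≤ supInner T x := by
      refine le_of_mul_le_mul_left ?_ hsw0
      calc √w * (β * √w) = β * w := by rw [← hww]; ring_nf; rw [Real.sqrt_sq hsw0.le]
        _ ≤ _ := hx
    have h5 : β * √k ≤ β * √w := by gcongr
    linarith
  · rw [Real.exp_le_exp, neg_le_neg_iff]
    apply le_of_eq
    have hpi := Real.pi_pos
    have : (β * √w / 2) ^ 2 = β ^ 2 * w / 4 := by rw [div_pow, mul_pow, Real.sq_sqrt hw.le]; norm_num
    rw [this]
    field_simp

/-- Uniformly over a set of small width, only few of the rows have a large inner product. -/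
theorem measure_exists_le_countIn_le {T : Set (EuclideanSpace ℝ (Fin n))} (hne : T.Nonempty)
    {σ β k : ℝ} (hσ : 0 < σ) (hT : ∀ v ∈ T, ‖v‖ ≤ σ) (hβ : 0 < β) (hk : 0 < k)
    (hω : 2 * gaussianWidth T ≤ β * √k) :
    gaussianRows n m {a | ∃ v ∈ T, k ≤ countIn {g | β < |inner ℝ g v|} a} ≤
      ENNReal.ofReal (Real.exp (-(β ^ 2 / (4 * Real.pi ^ 2 * σ ^ 2) * k) +
        2 * Real.exp (-(β ^ 2 / (4 * Real.pi ^ 2 * σ ^ 2))) * m)) := by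
  classical
  set D := β ^ 2 / (4 * Real.pi ^ 2 * σ ^ 2) with hD
  have hD0 : 0 ≤ D := by positivity
  have hsub : {a : Fin m → EuclideanSpace ℝ (Fin n) |
      ∃ v ∈ T, k ≤ countIn {g | β < |inner ℝ g v|} a} ⊆
      ⋃ s ∈ Finset.univ.filter fun s : Fin m → SignType => k ≤ signWeight s,
        {a | β * signWeight s ≤ supInner T (∑ i, (s i : ℝ) • a i)} := by
    rintro a ⟨v, hv, hkv⟩
    -- The signs that align all large inner products with `v`, and zero on the other rows.
    let s : Fin m → SignType := fun i =>
      if β < |inner ℝ (a i) v| then SignType.sign (inner ℝ (a i) v) else 0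
    have hterm : ∀ i, β * (s i : ℝ) ^ 2 ≤ s i * inner ℝ (a i) v ∧
        ((s i : ℝ)) ^ 2 = ({g : EuclideanSpace ℝ (Fin n) | β < |inner ℝ g v|}).indicator
          (1 : EuclideanSpace ℝ (Fin n) → ℝ) (a i) := by
      intro i
      by_cases h : β < |inner ℝ (a i) v|
      · have hs : s i = SignType.sign (inner ℝ (a i) v) := if_pos h
        have h0 : inner ℝ (a i) v ≠ 0 := by
          intro h0; rw [h0, abs_zero] at h; linarith
        rw [hs, Set.indicator_of_mem (by exact h)]
        rcases lt_or_gt_of_ne h0 with h1 | h1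
        · rw [abs_of_neg h1] at h
          simp [sign_neg h1]
          exact h.le
        · rw [abs_of_pos h1] at h
          simp [sign_pos h1]
          exact h.le
      · have hs : s i = 0 := if_neg h
        rw [hs, Set.indicator_of_notMem (by exact h)]
        simp
    have hw : signWeight s = countIn {g | β < |inner ℝ g v|} a := by
      rw [countIn_eq_sum, signWeight]
      exact Finset.sum_congr rfl fun i _ => (hterm i).2
    simp only [Set.mem_iUnion, Finset.mem_filter, Finset.mem_univ, true_and]
    refine ⟨s, by rw [hw]; exact hkv, ?_⟩
    calc β * signWeight s ≤ ∑ i, s i * inner ℝ (a i) v := by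
          rw [signWeight, Finset.mul_sum]
          exact Finset.sum_le_sum fun i _ => (hterm i).1
      _ = inner ℝ (∑ i, (s i : ℝ) • a i) v := by
          rw [sum_inner]
          simp only [inner_smul_left, conj_trivial]
      _ ≤ _ := inner_le_supInner hT _ hv
  calc _ ≤ ∑ s ∈ Finset.univ.filter fun s : Fin m → SignType => k ≤ signWeight s,
        gaussianRows n m {a | β * signWeight s ≤ supInner T (∑ i, (s i : ℝ) • a i)} :=
        (measure_mono hsub).trans (measure_biUnion_finset_le _ _)
    -- The exponent `2 D w` is split: one half gives `exp (-D k)`, the other makes the sum over all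
    -- patterns converge to a controlled size.
    _ ≤ ∑ s ∈ Finset.univ.filter fun s : Fin m → SignType => k ≤ signWeight s,
        ENNReal.ofReal (Real.exp (-(D * k)) * Real.exp (-(D * signWeight s))) := by
        refine Finset.sum_le_sum fun s hs => ?_
        have hks : k ≤ signWeight s := (Finset.mem_filter.1 hs).2
        refine (measure_signed_sum_le hne hσ hT hβ hk hω s hks).trans (ENNReal.ofReal_le_ofReal ?_)
        rw [← Real.exp_add, Real.exp_le_exp]
        have : D * k ≤ D * signWeight s := by gcongr
        linarith
    _ = ENNReal.ofReal (∑ s ∈ Finset.univ.filter fun s : Fin m → SignType => k ≤ signWeight s,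
        Real.exp (-(D * k)) * Real.exp (-(D * signWeight s))) :=
        (ENNReal.ofReal_sum_of_nonneg fun _ _ => by positivity).symm
    _ ≤ _ := by
        apply ENNReal.ofReal_le_ofReal
        rw [Real.exp_add]
        calc _ ≤ ∑ s : Fin m → SignType, Real.exp (-(D * k)) * Real.exp (-(D * signWeight s)) :=
              Finset.sum_le_sum_of_subset_of_nonneg (Finset.filter_subset _ _)
                fun _ _ _ => by positivity
          _ = Real.exp (-(D * k)) * ∑ s : Fin m → SignType, Real.exp (-(D * signWeight s)) :=
              (Finset.mul_sum _ _ _).symm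
          _ ≤ _ := by
              gcongr
              exact sum_exp_neg_signWeight_le D

end SignedSums

/-! ### Sign flips between a point and the net -/

section SignFlips

variable {n m : ℕ}

/-- The vectors that separate `x` from `y`. -/
def separating (x y : EuclideanSpace ℝ (Fin n)) : Set (EuclideanSpace ℝ (Fin n)) :=
  {g | ¬(0 ≤ inner ℝ g x ↔ 0 ≤ inner ℝ g y)}

lemma measurableSet_separating (x y : EuclideanSpace ℝ (Fin n)) :
    MeasurableSet (separating x y) := by
  refine MeasurableSet.compl ?_
  exact MeasurableSet.iff (measurableSet_le measurable_const (by fun_prop))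
    (measurableSet_le measurable_const (by fun_prop))

lemma normHamming_rowSigns (a : Fin m → EuclideanSpace ℝ (Fin n)) (x y : EuclideanSpace ℝ (Fin n)) :
    normHamming (rowSigns a x) (rowSigns a y) = countIn (separating x y) a / m := by
  classical
  rw [normHamming, hammingDist, countIn]
  congr 3
  ext i
  rw [Finset.mem_filter, Finset.mem_filter]
  simp [rowSigns, separating]

/-- If `|⟪g, y⟫| > β` and `|⟪g, x - y⟫| ≤ β`, the perturbation cannot change the sign. -/
lemma separating_subset (x y : EuclideanSpace ℝ (Fin n)) (β : ℝ) :
    separating x y ⊆ {g | |inner ℝ g y| ≤ β} ∪ {g | β < |inner ℝ g (x - y)|} := by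
  intro g hg
  by_contra hc
  simp only [Set.mem_union, Set.mem_ofPred_eq, not_or, not_le, not_lt] at hc
  obtain ⟨h1, h2⟩ := hc
  apply hg
  rw [inner_sub_right] at h2
  have h3 := abs_le.1 h2
  constructor
  · intro h
    by_contra! hlt
    rw [abs_of_neg hlt] at h1
    linarith
  · intro h
    rw [abs_of_nonneg h] at h1
    linarith

lemma countIn_separating_le (a : Fin m → EuclideanSpace ℝ (Fin n))
    (x y : EuclideanSpace ℝ (Fin n)) (β : ℝ) :
    (countIn (separating x y) a : ℝ) ≤
      countIn {g | |inner ℝ g y| ≤ β} a + countIn {g | β < |inner ℝ g (x - y)|} a := by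
  exact_mod_cast (countIn_mono (separating_subset x y β) a).trans (countIn_union_le _ _ a)

lemma normHamming_nonneg (a b : Fin m → Bool) : 0 ≤ normHamming a b := by
  unfold normHamming; positivity

lemma normHamming_le_one (a b : Fin m → Bool) : normHamming a b ≤ 1 := by
  unfold normHamming
  refine div_le_one_of_le₀ ?_ (Nat.cast_nonneg _)
  have := hammingDist_le_card_fintype (x := a) (y := b)
  simp only [Fintype.card_fin] at this
  exact_mod_cast this

lemma normHamming_triangle (a b c : Fin m → Bool) :
    normHamming a c ≤ normHamming a b + normHamming b c := by
  unfold normHamming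
  rw [← add_div]
  gcongr
  exact_mod_cast hammingDist_triangle a b c

lemma normHamming_comm (a b : Fin m → Bool) : normHamming a b = normHamming b a := by
  unfold normHamming; rw [hammingDist_comm]

lemma normHamming_self (a : Fin m → Bool) : normHamming a a = 0 := by
  simp [normHamming]

lemma stdGaussian_real_separating {x y : EuclideanSpace ℝ (Fin n)} (hx : ‖x‖ = 1) (hy : ‖y‖ = 1) :
    (stdGaussian (EuclideanSpace ℝ (Fin n))).real (separating x y) = ang x y := by
  rw [measureReal_def, separating, stdGaussian_sign_ne hx hy, ENNReal.toReal_ofReal (ang_nonneg x y)]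

lemma measurableSet_abs_inner_le (y : EuclideanSpace ℝ (Fin n)) (β : ℝ) :
    MeasurableSet {g : EuclideanSpace ℝ (Fin n) | |inner ℝ g y| ≤ β} :=
  measurableSet_le (by fun_prop) measurable_const

/-- For threshold one, a plain union bound over the rows is small when `m β` is small, where
Chernoff's bound is not. -/
lemma measure_one_le_countIn_le {y : EuclideanSpace ℝ (Fin n)} (hy : ‖y‖ = 1) (β : ℝ) :
    gaussianRows n m {a | (1 : ℝ) ≤ countIn {g | |inner ℝ g y| ≤ β} a} ≤ ENNReal.ofReal (m * β) := by
  classical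
  have hsub : {a : Fin m → EuclideanSpace ℝ (Fin n) |
      (1 : ℝ) ≤ countIn {g | |inner ℝ g y| ≤ β} a} ⊆
      ⋃ i : Fin m, Function.eval i ⁻¹' {g | |inner ℝ g y| ≤ β} := by
    intro a ha
    have h1 : 0 < countIn {g | |inner ℝ g y| ≤ β} a := by
      have : (1 : ℝ) ≤ countIn {g | |inner ℝ g y| ≤ β} a := ha
      exact_mod_cast this
    obtain ⟨i, hi⟩ := Finset.card_pos.1 h1
    exact Set.mem_iUnion.2 ⟨i, (Finset.mem_filter.1 hi).2⟩
  refine (measure_mono hsub).trans ((measure_iUnion_fintype_le _ _).trans ?_)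
  rw [ENNReal.ofReal_mul (Nat.cast_nonneg _), ENNReal.ofReal_natCast]
  calc _ ≤ ∑ _i : Fin m, ENNReal.ofReal β := by
        refine Finset.sum_le_sum fun i _ => ?_
        rw [gaussianRows, (measurePreserving_eval _ i).measure_preimage
          (measurableSet_abs_inner_le y β).nullMeasurableSet]
        exact stdGaussian_abs_inner_le hy β
    _ = _ := by simp

lemma measure_exists_mem_finset_le {α ι : Type*} [MeasurableSpace α] {μ : Measure α} (X : Finset ι)
    (B : ι → Set α) {q : ℝ} (h : ∀ x ∈ X, μ (B x) ≤ ENNReal.ofReal q) :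
    μ {a | ∃ x ∈ X, a ∈ B x} ≤ ENNReal.ofReal (X.card * q) := by
  have e : {a | ∃ x ∈ X, a ∈ B x} = ⋃ x ∈ X, B x := by ext; simp
  rw [e]
  refine (measure_biUnion_finset_le _ _).trans ((Finset.sum_le_sum h).trans ?_)
  rw [Finset.sum_const, nsmul_eq_mul, ENNReal.ofReal_mul (Nat.cast_nonneg _), ENNReal.ofReal_natCast]

lemma log_two_le_log_inv {δ : ℝ} (hδ : 0 < δ) (hδ2 : δ ≤ 1 / 2) : Real.log 2 ≤ Real.log δ⁻¹ := by
  apply Real.log_le_log two_pos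
  rw [le_inv_comm₀ two_pos hδ]
  linarith

lemma card_le_exp_of_log_le {k : ℕ} {b : ℝ} (h : Real.log k ≤ b) : (k : ℝ) ≤ Real.exp b := by
  rcases Nat.eq_zero_or_pos k with rfl | hk
  · simpa using (Real.exp_pos b).le
  · exact (Real.log_le_iff_le_exp (by exact_mod_cast hk)).1 h

lemma card_le_one_of_log_lt {k : ℕ} (h : Real.log k < Real.log 2) : k ≤ 1 := by
  by_contra! hk
  have : Real.log 2 ≤ Real.log k := Real.log_le_log two_pos (by exact_mod_cast hk)
  linarith

/-- If few rows are almost orthogonal to the net points and few rows have a large inner product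
with the local set, then few signs flip between a point and a nearby net point. -/
lemma measure_exists_normHamming_le {K : Set (EuclideanSpace ℝ (Fin n))} (hm : 0 < m)
    (X : Finset (EuclideanSpace ℝ (Fin n))) (hXK : ∀ x ∈ X, x ∈ K)
    {ε β k η q₁ q₂ : ℝ}
    (hkη : ∀ i j : ℕ, (i : ℝ) < k → (j : ℝ) < k → (i + j : ℝ) ≤ η * m)
    (h₁ : ∀ y ∈ X, gaussianRows n m {a | k ≤ countIn {g | |inner ℝ g y| ≤ β} a} ≤ ENNReal.ofReal q₁)
    (h₂ : gaussianRows n m {a | ∃ v ∈ localSet K ε, k ≤ countIn {g | β < |inner ℝ g v|} a} ≤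
      ENNReal.ofReal q₂) (hq₁ : 0 ≤ q₁) (hq₂ : 0 ≤ q₂) :
    gaussianRows n m {a | ∃ x ∈ K, ∃ y ∈ X, ‖x - y‖ ≤ ε ∧
      η < normHamming (rowSigns a x) (rowSigns a y)} ≤ ENNReal.ofReal (X.card * q₁ + q₂) := by
  have hm' : (0 : ℝ) < m := by exact_mod_cast hm
  rw [ENNReal.ofReal_add (by positivity) hq₂]
  refine (measure_mono ?_).trans ((measure_union_le _ _).trans
    (add_le_add (measure_exists_mem_finset_le X _ h₁) h₂))
  rintro a ⟨x, hx, y, hy, hxy, hlt⟩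
  by_contra hc
  simp only [Set.mem_union, Set.mem_ofPred_eq, not_or, not_exists, not_and, not_le] at hc
  obtain ⟨hc1, hc2⟩ := hc
  have h1 := hc1 y hy
  have h2 := hc2 (x - y) ⟨x, hx, y, hXK y hy, rfl, hxy⟩
  rw [normHamming_rowSigns, lt_div_iff₀ hm'] at hlt
  have h3 := countIn_separating_le a x y β
  have h4 := hkη _ _ h1 h2
  linarith

/-- The **key estimate**: uniformly over `K`, few signs flip between a point of `K` and a nearby
point of a net. -/
theorem measure_exists_normHamming_net_le {K : Set (EuclideanSpace ℝ (Fin n))}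
    (hK : K ⊆ Metric.sphere 0 1) {δ ε : ℝ} (hδ : 0 < δ) (hδ2 : δ ≤ 1 / 2)
    (hε : ε = 1 / 5120000 * δ / √(Real.log δ⁻¹)) (X : Finset (EuclideanSpace ℝ (Fin n)))
    (hXK : ∀ x ∈ X, x ∈ K) (hX : 10 ^ 12 * Real.log X.card ≤ δ * m)
    (hω : 10 ^ 12 * gaussianWidth (localSet K ε) ^ 2 ≤ δ ^ 3 * m) :
    gaussianRows n m {a | ∃ x ∈ K, ∃ y ∈ X, ‖x - y‖ ≤ ε ∧
      δ / 100 < normHamming (rowSigns a x) (rowSigns a y)} ≤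
        ENNReal.ofReal (Real.exp (-(δ * m / 3200))) := by
  rcases Nat.eq_zero_or_pos m with rfl | hm
  · simpa using prob_le_one
  rcases K.eq_empty_or_nonempty with rfl | hne
  · simp
  have hm' : (1 : ℝ) ≤ m := by exact_mod_cast hm
  have hL2 := log_two_le_log_inv hδ hδ2
  have hlog2 := Real.log_two_gt_d9
  set L := Real.log δ⁻¹ with hL
  have hL0 : 0 < L := by linarith
  have hsL : 0 < √L := Real.sqrt_pos.2 hL0
  have hε0 : 0 < ε := by rw [hε]; positivity
  set β := δ / 6400 with hβ
  have hβ0 : 0 < β := by positivity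
  have hT : ∀ v ∈ localSet K ε, ‖v‖ ≤ ε := localSet_norm_le
  have hTne : (localSet K ε).Nonempty := ⟨0, zero_mem_localSet hne hε0.le⟩
  have hunit : ∀ y ∈ X, ‖y‖ = 1 := fun y hy => by simpa using hK (hXK y hy)
  set D := β ^ 2 / (4 * Real.pi ^ 2 * ε ^ 2) with hD
  have hpi2 : Real.pi ^ 2 ≤ 10 := by
    have := Real.pi_lt_d2
    nlinarith [Real.pi_pos]
  have hDL : 16000 * L ≤ D := by
    have hpp := Real.pi_pos
    have e : D = 160000 * L / Real.pi ^ 2 := by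
      rw [hD, hε, hβ]
      have : √L ^ 2 = L := Real.sq_sqrt hL0.le
      field_simp
      rw [this]
      norm_num
    rw [e, le_div_iff₀ (by positivity)]
    nlinarith
  have hD0 : 8000 ≤ D := by nlinarith
  have hexpD : Real.exp (-D) ≤ δ := by
    calc Real.exp (-D) ≤ Real.exp (-L) := by rw [Real.exp_le_exp]; linarith
      _ = δ := by rw [hL, Real.log_inv, neg_neg, Real.exp_log hδ]
  have hw0 : 0 ≤ gaussianWidth (localSet K ε) :=
    gaussianWidth_nonneg hT (zero_mem_localSet hne hε0.le)
  set ω := gaussianWidth (localSet K ε)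
  have hdm : 0 < δ * m := by positivity
  have htail : ∀ k, 0 < k → 4 * ω ^ 2 ≤ β ^ 2 * k →
      gaussianRows n m {a | ∃ v ∈ localSet K ε, k ≤ countIn {g | β < |inner ℝ g v|} a} ≤
        ENNReal.ofReal (Real.exp (-(8000 * k) + 2 * (δ * m))) := by
    intro k hk hωk
    have h1 : 2 * ω ≤ β * √k := by
      refine le_of_sq_le_sq ?_ (by positivity)
      rw [mul_pow, mul_pow, Real.sq_sqrt hk.le]
      linarith
    refine (measure_exists_le_countIn_le hTne hε0 hT hβ0 hk h1).trans
      (ENNReal.ofReal_le_ofReal ?_)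
    rw [Real.exp_le_exp, ← hD]
    have h2 : 8000 * k ≤ D * k := by gcongr
    have h3 : Real.exp (-D) * m ≤ δ * m := by gcongr
    linarith
  -- For large `δ m` the threshold is proportional to `δ m`, and constant factors are absorbed by
  -- the exponent. For small `δ m` the threshold is one: no flips at all.
  rcases le_or_gt 1600 (δ * m) with hbig | hsmall
  · set k := δ * m / 200 with hk
    have hk0 : 0 < k := by positivity
    have hcard : (X.card : ℝ) ≤ Real.exp (δ * m / 10 ^ 12) :=
      card_le_exp_of_log_le (by rw [le_div_iff₀ (by norm_num)]; linarith)
    have h2 := htail k hk0 (by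
      rw [hk, hβ]
      have : 0 ≤ δ ^ 3 * m := by positivity
      have e : (δ / 6400) ^ 2 * (δ * m / 200) = δ ^ 3 * m / (6400 ^ 2 * 200) := by ring
      rw [e]
      linarith)
    have h1 : ∀ y ∈ X, gaussianRows n m {a | k ≤ countIn {g | |inner ℝ g y| ≤ β} a} ≤
        ENNReal.ofReal (Real.exp (2 * β * m - k)) := fun y hy =>
      measure_le_countIn_le (measurableSet_abs_inner_le y β) (stdGaussian_abs_inner_le (hunit y hy) β)
        hβ0.le k
    refine (measure_exists_normHamming_le hm X hXK (fun i j hi hj => ?_) h1 h2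
      (Real.exp_pos _).le (Real.exp_pos _).le).trans (ENNReal.ofReal_le_ofReal ?_)
    · rw [hk] at hi hj; linarith
    · have e1 : X.card * Real.exp (2 * β * m - k) ≤ Real.exp (-(δ * m / 3200) - 1) := by
        calc X.card * Real.exp (2 * β * m - k)
            ≤ Real.exp (δ * m / 10 ^ 12) * Real.exp (2 * β * m - k) := by gcongr
          _ = Real.exp (δ * m / 10 ^ 12 + (2 * β * m - k)) := (Real.exp_add _ _).symm
          _ ≤ _ := by
            rw [Real.exp_le_exp, hk, hβ]
            linarith
      have e2 : Real.exp (-(8000 * k) + 2 * (δ * m)) ≤ Real.exp (-(δ * m / 3200) - 1) := by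
        rw [Real.exp_le_exp, hk]
        linarith
      have e3 : Real.exp (-(δ * m / 3200) - 1) ≤ Real.exp (-(δ * m / 3200)) / 2 := by
        rw [Real.exp_sub]
        have := Real.add_one_le_exp (1 : ℝ)
        gcongr
        linarith
      linarith
  -- Here the entropy hypothesis makes `log X.card` smaller than `log 2`. Both failure probabilities
  -- are at most `1/4`, and `exp (-(δ m / 3200)) ≥ 1/2`.
  · have hcard : X.card ≤ 1 := by
      apply card_le_one_of_log_lt
      linarith
    have h2 := htail 1 one_pos (by
      have h3 : δ ^ 3 * m ≤ 1600 * δ ^ 2 := by nlinarith [sq_nonneg δ]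
      have : 0 < δ ^ 2 := by positivity
      have e : β ^ 2 * 1 = δ ^ 2 / 40960000 := by rw [hβ]; ring
      rw [e]
      linarith)
    have h1 : ∀ y ∈ X, gaussianRows n m {a | 1 ≤ (countIn {g | |inner ℝ g y| ≤ β} a : ℝ)} ≤
        ENNReal.ofReal (m * β) := fun y hy => measure_one_le_countIn_le (hunit y hy) β
    refine (measure_exists_normHamming_le hm X hXK (fun i j hi hj => ?_) h1 h2
      (by positivity) (Real.exp_pos _).le).trans (ENNReal.ofReal_le_ofReal ?_)
    · have hi' : i = 0 := by
        have : i < 1 := by exact_mod_cast hi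
        omega
      have hj' : j = 0 := by
        have : j < 1 := by exact_mod_cast hj
        omega
      subst hi' hj'
      simp only [Nat.cast_zero, add_zero]
      positivity
    · have e1 : (X.card : ℝ) * (m * β) ≤ 1 / 4 := by
        have : (X.card : ℝ) ≤ 1 := by exact_mod_cast hcard
        calc (X.card : ℝ) * (m * β) ≤ 1 * (m * β) := by gcongr
          _ ≤ 1 / 4 := by rw [hβ]; linarith
      have e2 : Real.exp (-(8000 * 1) + 2 * (δ * m)) ≤ 1 / 4 := by
        have h4 : Real.exp (-(8000 * 1) + 2 * (δ * m)) ≤ Real.exp (-3) := by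
          rw [Real.exp_le_exp]; linarith
        have h5 : Real.exp (-3) ≤ 1 / 4 := by
          rw [Real.exp_neg, one_div]
          have := Real.add_one_le_exp (3 : ℝ)
          gcongr
          linarith
        exact h4.trans h5
      have e3 := Real.add_one_le_exp (-(δ * m / 3200))
      linarith

end SignFlips

/-! ### Both embeddings for `δ ≤ 1 / 2` -/

section SmallScale

variable {n m : ℕ} {K : Set (EuclideanSpace ℝ (Fin n))} {δ ε : ℝ}

/-- Halving the rate absorbs the factor `3`, once `u` is large. -/
lemma exp_add_two_mul_exp_le {u v : ℝ} (hu : 12800 ≤ u) (hv : v ≤ -(u / 3200)) :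
    Real.exp (-(u / 3200)) + 2 * Real.exp v ≤ Real.exp (-(u / 6400)) := by
  have h1 : Real.exp v ≤ Real.exp (-(u / 3200)) := Real.exp_le_exp.2 hv
  have e : Real.exp (-(u / 3200)) = Real.exp (-(u / 6400)) * Real.exp (-(u / 6400)) := by
    rw [← Real.exp_add]; ring_nf
  have h2 : Real.exp (-(u / 6400)) ≤ 1 / 3 := by
    have h3 : Real.exp (-(u / 6400)) ≤ Real.exp (-2) := by rw [Real.exp_le_exp]; linarith
    have h4 : Real.exp (-2) ≤ 1 / 3 := by
      rw [Real.exp_neg, one_div]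
      have := Real.add_one_le_exp (2 : ℝ)
      gcongr
      linarith
    linarith
  nlinarith [Real.exp_pos (-(u / 6400))]

lemma net_radius_bounds (hδ : 0 < δ) (hδ2 : δ ≤ 1 / 2)
    (hε : ε = 1 / 5120000 * δ / √(Real.log δ⁻¹)) :
    0 < ε ∧ ε ≤ δ / 1000 ∧ δ / √(Real.log δ⁻¹) ≤ 3 / 2 * δ := by
  have hL2 := log_two_le_log_inv hδ hδ2
  have hlog2 := Real.log_two_gt_d9
  have hs : 2 / 3 ≤ √(Real.log δ⁻¹) := by
    apply Real.le_sqrt_of_sq_le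
    have : ((2 : ℝ) / 3) ^ 2 ≤ 0.6931471803 := by norm_num
    linarith
  have hs0 : 0 < √(Real.log δ⁻¹) := by linarith
  have h3 : δ / √(Real.log δ⁻¹) ≤ 3 / 2 * δ := by
    rw [div_le_iff₀ hs0]
    nlinarith
  refine ⟨by rw [hε]; positivity, ?_, h3⟩
  rw [hε, mul_div_assoc]
  linarith

/-- The global embedding for `δ ≤ 1 / 2`. -/
theorem measure_not_isBinaryEmbedding_le (hK : K ⊆ Metric.sphere 0 1) (hδ : 0 < δ) (hδ2 : δ ≤ 1 / 2)
    (hε : ε = 1 / 5120000 * δ / √(Real.log δ⁻¹))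
    (hN : 10 ^ 12 * logCoveringNumber K ε ≤ δ ^ 2 * m)
    (hω : 10 ^ 12 * gaussianWidth (localSet K ε) ^ 2 ≤ δ ^ 3 * m) :
    gaussianRows n m {a | ¬IsBinaryEmbedding δ (rowSigns a) K} ≤
      ENNReal.ofReal (Real.exp (-(δ ^ 2 * m / 6400))) := by
  classical
  rcases Nat.eq_zero_or_pos m with rfl | hm
  · simpa using prob_le_one
  have hm' : (0 : ℝ) < m := by exact_mod_cast hm
  obtain ⟨hε0, hεδ, -⟩ := net_radius_bounds hδ hδ2 hε
  obtain ⟨X, hXK, hX, hlog⟩ := exists_minimal_net hK hε0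
  rw [hlog] at hN
  have hunit : ∀ y ∈ K, ‖y‖ = 1 := fun y hy => by simpa using hK hy
  have hδm : δ ^ 2 * m ≤ δ * m := by
    have : δ ^ 2 ≤ δ := by nlinarith
    gcongr
  have hmain := measure_exists_normHamming_net_le hK hδ hδ2 hε X hXK (hN.trans hδm) hω
  let B : EuclideanSpace ℝ (Fin n) × EuclideanSpace ℝ (Fin n) →
      Set (Fin m → EuclideanSpace ℝ (Fin n)) := fun p =>
    {a | δ / 4 * m ≤ |countIn (separating p.1 p.2) a - ang p.1 p.2 * m|}
  have hB : ∀ p ∈ X.offDiag, gaussianRows n m (B p) ≤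
      ENNReal.ofReal (2 * Real.exp (-(2 * (δ / 4) ^ 2 * m))) := by
    intro p hp
    obtain ⟨h1, h2, -⟩ := Finset.mem_offDiag.1 hp
    have h := measure_abs_countIn_sub_le (m := m) (ν := stdGaussian (EuclideanSpace ℝ (Fin n)))
      (measurableSet_separating p.1 p.2) (u := δ / 4) (by positivity)
    rw [stdGaussian_real_separating (hunit _ (hXK _ h1)) (hunit _ (hXK _ h2))] at h
    exact h
  have hpairs := measure_exists_mem_finset_le X.offDiag B hB
  have hsub : {a : Fin m → EuclideanSpace ℝ (Fin n) | ¬IsBinaryEmbedding δ (rowSigns a) K} ⊆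
      {a | ∃ x ∈ K, ∃ y ∈ X, ‖x - y‖ ≤ ε ∧ δ / 100 < normHamming (rowSigns a x) (rowSigns a y)} ∪
        {a | ∃ p ∈ X.offDiag, a ∈ B p} := by
    intro a ha
    by_contra hc
    simp only [Set.mem_union, Set.mem_ofPred_eq, not_or, not_exists, not_and, not_lt] at hc
    obtain ⟨hc1, hc2⟩ := hc
    apply ha
    intro x hx y hy
    obtain ⟨x', hx', hxx'⟩ := hX x hx
    obtain ⟨y', hy', hyy'⟩ := hX y hy
    have hx1 := hc1 x hx x' hx' hxx'
    have hy1 := hc1 y hy y' hy' hyy'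
    have hxy' : |normHamming (rowSigns a x') (rowSigns a y') - ang x' y'| ≤ δ / 4 := by
      rcases eq_or_ne x' y' with rfl | hne
      · have : ang x' x' = 0 := by
          rw [ang, InnerProductGeometry.angle_self, zero_div]
          intro h0
          have := hunit _ (hXK _ hx')
          rw [h0, norm_zero] at this
          norm_num at this
        rw [normHamming_self, this, sub_zero, abs_zero]
        positivity
      · have h := hc2 (x', y') (Finset.mem_offDiag.2 ⟨hx', hy', hne⟩)
        simp only [B, Set.mem_ofPred_eq, not_le] at h
        rw [normHamming_rowSigns]
        have e : (countIn (separating x' y') a : ℝ) / m - ang x' y' =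
            (countIn (separating x' y') a - ang x' y' * m) / m := by field_simp
        rw [e, abs_div, abs_of_pos hm', div_le_iff₀ hm']
        exact h.le
    have hax := (ang_le_norm_sub_div_two (hunit x hx) (hunit _ (hXK _ hx')))
    have hay := (ang_le_norm_sub_div_two (hunit y hy) (hunit _ (hXK _ hy')))
    have t1 := ang_triangle x x' y
    have t2 := ang_triangle x' y' y
    have t3 := ang_triangle x' x y'
    have t4 := ang_triangle x y y'
    rw [ang_comm y' y] at t2
    rw [ang_comm x' x] at t3
    have s1 := normHamming_triangle (rowSigns a x) (rowSigns a x') (rowSigns a y)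
    have s2 := normHamming_triangle (rowSigns a x') (rowSigns a y') (rowSigns a y)
    have s3 := normHamming_triangle (rowSigns a x') (rowSigns a x) (rowSigns a y')
    have s4 := normHamming_triangle (rowSigns a x) (rowSigns a y) (rowSigns a y')
    rw [normHamming_comm (rowSigns a y') (rowSigns a y)] at s2
    rw [normHamming_comm (rowSigns a x') (rowSigns a x)] at s3
    rw [abs_le] at hxy' ⊢
    -- The total error is at most `δ / 4` on the net, `2 δ / 100` from flips and `ε` from the two
    -- angles.
    constructor <;> linarith
  have htot := (measure_mono hsub).trans ((measure_union_le _ _).trans (add_le_add hmain hpairs))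
  refine htot.trans ?_
  rw [← ENNReal.ofReal_add (Real.exp_pos _).le (by positivity)]
  apply ENNReal.ofReal_le_ofReal
  have hδm0 : 0 ≤ δ ^ 2 * m := by positivity
  -- With at most one net point there are no pairs. Otherwise `log X.card ≥ log 2` forces `δ² m` to
  -- be huge, and the union bound costs only a smaller rate.
  rcases Nat.lt_or_ge X.card 2 with hc | hc
  · have h0 : X.offDiag.card = 0 := by
      rw [Finset.offDiag_card]
      interval_cases X.card <;> simp
    rw [h0, Nat.cast_zero, zero_mul, add_zero, Real.exp_le_exp]
    linarith
  · have hlog2 : Real.log 2 ≤ Real.log X.card := Real.log_le_log two_pos (by exact_mod_cast hc)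
    have hl := Real.log_two_gt_d9
    have hcard : (X.card : ℝ) ≤ Real.exp (δ ^ 2 * m / 10 ^ 12) :=
      card_le_exp_of_log_le (by rw [le_div_iff₀ (by norm_num)]; linarith)
    have hoff : (X.offDiag.card : ℝ) ≤ X.card * X.card := by
      rw [Finset.offDiag_card]
      exact_mod_cast Nat.sub_le _ _
    have h1 : (X.offDiag.card : ℝ) * (2 * Real.exp (-(2 * (δ / 4) ^ 2 * m))) ≤
        2 * Real.exp (δ ^ 2 * m / 10 ^ 12 + δ ^ 2 * m / 10 ^ 12 - δ ^ 2 * m / 8) := by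
      rw [sub_eq_add_neg, Real.exp_add, Real.exp_add]
      have e : -(2 * (δ / 4) ^ 2 * m) = -(δ ^ 2 * m / 8) := by ring
      rw [e]
      calc _ ≤ (Real.exp (δ ^ 2 * m / 10 ^ 12) * Real.exp (δ ^ 2 * m / 10 ^ 12)) *
            (2 * Real.exp (-(δ ^ 2 * m / 8))) := by
            gcongr
            exact hoff.trans (by gcongr)
        _ = _ := by ring
    have h2 := exp_add_two_mul_exp_le (u := δ ^ 2 * m)
      (v := δ ^ 2 * m / 10 ^ 12 + δ ^ 2 * m / 10 ^ 12 - δ ^ 2 * m / 8) (by linarith) (by linarith)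
    have h3 : Real.exp (-(δ * m / 3200)) ≤ Real.exp (-(δ ^ 2 * m / 3200)) := by
      rw [Real.exp_le_exp]; linarith
    linarith

/-- The local embedding for `δ ≤ 1 / 2`. -/
theorem measure_not_isLocalBinaryEmbedding_le (hK : K ⊆ Metric.sphere 0 1) (hδ : 0 < δ)
    (hδ2 : δ ≤ 1 / 2) (hε : ε = 1 / 5120000 * δ / √(Real.log δ⁻¹))
    (hN : 10 ^ 12 * logCoveringNumber K ε ≤ δ * m)
    (hω : 10 ^ 12 * gaussianWidth (localSet K ε) ^ 2 ≤ δ ^ 3 * m) :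
    gaussianRows n m {a | ¬IsLocalBinaryEmbedding (1 / 100) 5 δ (rowSigns a) K} ≤
      ENNReal.ofReal (Real.exp (-(δ * m / 6400))) := by
  classical
  rcases Nat.eq_zero_or_pos m with rfl | hm
  · simpa using prob_le_one
  have hm' : (0 : ℝ) < m := by exact_mod_cast hm
  obtain ⟨hε0, hεδ, hclose⟩ := net_radius_bounds hδ hδ2 hε
  obtain ⟨X, hXK, hX, hlog⟩ := exists_minimal_net hK hε0
  rw [hlog] at hN
  have hunit : ∀ y ∈ K, ‖y‖ = 1 := fun y hy => by simpa using hK hy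
  have hmain := measure_exists_normHamming_net_le hK hδ hδ2 hε X hXK hN hω
  let B : EuclideanSpace ℝ (Fin n) × EuclideanSpace ℝ (Fin n) →
      Set (Fin m → EuclideanSpace ℝ (Fin n)) := fun p =>
    {a | (δ / 2 ≤ ‖p.1 - p.2‖ ∧ countIn (separating p.1 p.2) a ≤ δ * m / 28) ∨
      (‖p.1 - p.2‖ ≤ 2 * δ ∧ 4 * (δ * m) ≤ countIn (separating p.1 p.2) a)}
  have hB : ∀ p ∈ X.offDiag, gaussianRows n m (B p) ≤
      ENNReal.ofReal (2 * Real.exp (-(δ * m / 28))) := by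
    intro p hp
    obtain ⟨h1, h2, -⟩ := Finset.mem_offDiag.1 hp
    have hp1 := hunit _ (hXK _ h1)
    have hp2 := hunit _ (hXK _ h2)
    have hprob : stdGaussian (EuclideanSpace ℝ (Fin n)) (separating p.1 p.2) =
        ENNReal.ofReal (ang p.1 p.2) := stdGaussian_sign_ne hp1 hp2
    have hsplit : B p ⊆
        {a | δ / 2 ≤ ‖p.1 - p.2‖ ∧ countIn (separating p.1 p.2) a ≤ δ * m / 28} ∪
        {a | ‖p.1 - p.2‖ ≤ 2 * δ ∧ 4 * (δ * m) ≤ countIn (separating p.1 p.2) a} := fun a ha => ha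
    rw [two_mul, ENNReal.ofReal_add (Real.exp_pos _).le (Real.exp_pos _).le]
    refine (measure_mono hsplit).trans ((measure_union_le _ _).trans (add_le_add ?_ ?_))
    · by_cases hd : δ / 2 ≤ ‖p.1 - p.2‖
      -- `(δ / 2) / π ≥ δ / 7`. The threshold `δ m / 28` is a quarter of this mean bound and still
      -- exceeds the loss `2 δ m / 100` from flips.
      · have hang : δ / 7 ≤ ang p.1 p.2 := by
          refine le_trans ?_ (norm_sub_div_pi_le_ang hp1 hp2)
          have := Real.pi_lt_d2
          rw [le_div_iff₀ Real.pi_pos]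
          nlinarith
        have h := measure_countIn_le_le (m := m) (ν := stdGaussian (EuclideanSpace ℝ (Fin n)))
          (measurableSet_separating p.1 p.2) (p := δ / 7)
          (by rw [hprob]; exact ENNReal.ofReal_le_ofReal hang) (δ * m / 28)
        refine (measure_mono fun a ha => ha.2).trans (h.trans (ENNReal.ofReal_le_ofReal ?_))
        rw [Real.exp_le_exp]
        linarith
      · simp [hd]
    · by_cases hd : ‖p.1 - p.2‖ ≤ 2 * δ
      · have hang : ang p.1 p.2 ≤ δ := by
          have := ang_le_norm_sub_div_two hp1 hp2
          linarith
        have h := measure_le_countIn_le (m := m) (ν := stdGaussian (EuclideanSpace ℝ (Fin n)))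
          (measurableSet_separating p.1 p.2) (p := δ)
          (by rw [hprob]; exact ENNReal.ofReal_le_ofReal hang) hδ.le (4 * (δ * m))
        refine (measure_mono fun a ha => ha.2).trans (h.trans (ENNReal.ofReal_le_ofReal ?_))
        rw [Real.exp_le_exp]
        nlinarith
      · simp [hd]
  have hpairs := measure_exists_mem_finset_le X.offDiag B hB
  have hsub : {a : Fin m → EuclideanSpace ℝ (Fin n) |
      ¬IsLocalBinaryEmbedding (1 / 100) 5 δ (rowSigns a) K} ⊆
      {a | ∃ x ∈ K, ∃ y ∈ X, ‖x - y‖ ≤ ε ∧ δ / 100 < normHamming (rowSigns a x) (rowSigns a y)} ∪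
        {a | ∃ p ∈ X.offDiag, a ∈ B p} := by
    intro a ha
    by_contra hc
    simp only [Set.mem_union, Set.mem_ofPred_eq, not_or, not_exists, not_and, not_lt] at hc
    obtain ⟨hc1, hc2⟩ := hc
    apply ha
    have hpair : ∀ x ∈ X, ∀ y ∈ X, x ≠ y →
        (δ / 2 ≤ ‖x - y‖ → δ / 28 < normHamming (rowSigns a x) (rowSigns a y)) ∧
        (‖x - y‖ ≤ 2 * δ → normHamming (rowSigns a x) (rowSigns a y) < 4 * δ) := by
      intro x hx y hy hxy
      have h := hc2 (x, y) (Finset.mem_offDiag.2 ⟨hx, hy, hxy⟩)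
      simp only [B, Set.mem_ofPred_eq, not_or, not_and, not_le] at h
      rw [normHamming_rowSigns, lt_div_iff₀ hm', div_lt_iff₀ hm']
      exact ⟨fun hd => by have := h.1 hd; linarith, fun hd => by have := h.2 hd; linarith⟩
    refine ⟨fun x hx y hy hxy => ?_, fun x hx y hy hxy => ?_⟩
    · obtain ⟨x', hx', hxx'⟩ := hX x hx
      obtain ⟨y', hy', hyy'⟩ := hX y hy
      have hx1 := hc1 x hx x' hx' hxx'
      have hy1 := hc1 y hy y' hy' hyy'
      have hd : δ / 2 ≤ ‖x' - y'‖ := by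
        have e : x - y = (x - x') + (x' - y') - (y - y') := by abel
        have := norm_sub_le ((x - x') + (x' - y')) (y - y')
        rw [← e] at this
        have := norm_add_le (x - x') (x' - y')
        linarith
      have hne : x' ≠ y' := by
        intro h
        rw [h, sub_self, norm_zero] at hd
        linarith
      have h := (hpair x' hx' y' hy' hne).1 hd
      have s3 := normHamming_triangle (rowSigns a x') (rowSigns a x) (rowSigns a y')
      have s4 := normHamming_triangle (rowSigns a x) (rowSigns a y) (rowSigns a y')
      rw [normHamming_comm (rowSigns a x') (rowSigns a x)] at s3
      linarith
    · obtain ⟨x', hx', hxx'⟩ := hX x hx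
      obtain ⟨y', hy', hyy'⟩ := hX y hy
      have hx1 := hc1 x hx x' hx' hxx'
      have hy1 := hc1 y hy y' hy' hyy'
      -- At this scale the Hamming distance and the angle are each of order `δ`, so bounding both
      -- suffices and no concentration around the mean is needed.
      have hd : ‖x' - y'‖ ≤ 2 * δ := by
        have e : x' - y' = (x - y) - (x - x') + (y - y') := by abel
        have := norm_add_le ((x - y) - (x - x')) (y - y')
        rw [← e] at this
        have := norm_sub_le (x - y) (x - x')
        linarith
      have h : normHamming (rowSigns a x') (rowSigns a y') ≤ 4 * δ := by
        rcases eq_or_ne x' y' with rfl | hne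
        · rw [normHamming_self]; positivity
        · exact ((hpair x' hx' y' hy' hne).2 hd).le
      have s1 := normHamming_triangle (rowSigns a x) (rowSigns a x') (rowSigns a y)
      have s2 := normHamming_triangle (rowSigns a x') (rowSigns a y') (rowSigns a y)
      rw [normHamming_comm (rowSigns a y') (rowSigns a y)] at s2
      have s5 := normHamming_nonneg (rowSigns a x) (rowSigns a y)
      have s6 := ang_nonneg x y
      have s7 := ang_le_norm_sub_div_two (hunit x hx) (hunit y hy)
      rw [abs_le]
      constructor <;> linarith
  have htot := (measure_mono hsub).trans ((measure_union_le _ _).trans (add_le_add hmain hpairs))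
  refine htot.trans ?_
  rw [← ENNReal.ofReal_add (Real.exp_pos _).le (by positivity)]
  apply ENNReal.ofReal_le_ofReal
  have hδm0 : 0 ≤ δ * m := by positivity
  rcases Nat.lt_or_ge X.card 2 with hc | hc
  · have h0 : X.offDiag.card = 0 := by
      rw [Finset.offDiag_card]
      interval_cases X.card <;> simp
    rw [h0, Nat.cast_zero, zero_mul, add_zero, Real.exp_le_exp]
    linarith
  · have hlog2 : Real.log 2 ≤ Real.log X.card := Real.log_le_log two_pos (by exact_mod_cast hc)
    have hl := Real.log_two_gt_d9
    have hcard : (X.card : ℝ) ≤ Real.exp (δ * m / 10 ^ 12) :=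
      card_le_exp_of_log_le (by rw [le_div_iff₀ (by norm_num)]; linarith)
    have hoff : (X.offDiag.card : ℝ) ≤ X.card * X.card := by
      rw [Finset.offDiag_card]
      exact_mod_cast Nat.sub_le _ _
    have h1 : (X.offDiag.card : ℝ) * (2 * Real.exp (-(δ * m / 28))) ≤
        2 * Real.exp (δ * m / 10 ^ 12 + δ * m / 10 ^ 12 - δ * m / 28) := by
      rw [sub_eq_add_neg, Real.exp_add, Real.exp_add]
      calc _ ≤ (Real.exp (δ * m / 10 ^ 12) * Real.exp (δ * m / 10 ^ 12)) *
            (2 * Real.exp (-(δ * m / 28))) := by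
            gcongr
            exact hoff.trans (by gcongr)
        _ = _ := by ring
    have h2 := exp_add_two_mul_exp_le (u := δ * m)
      (v := δ * m / 10 ^ 12 + δ * m / 10 ^ 12 - δ * m / 28) (by linarith) (by linarith)
    linarith

end SmallScale

/-! ### Transfer to the random matrix, and `δ` close to one -/

lemma IsStdGaussianMatrix.withProbAtLeast {n m : ℕ} {Ω : Type*} [MeasurableSpace Ω] {P : Measure Ω}
    [IsProbabilityMeasure P] {A : Ω → Matrix (Fin m) (Fin n) ℝ} (hA : IsStdGaussianMatrix P A)
    {F : (EuclideanSpace ℝ (Fin n) → (Fin m → Bool)) → Prop} {q : ℝ} (hq : 0 ≤ q)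
    (h : gaussianRows n m {a | ¬F (rowSigns a)} ≤ ENNReal.ofReal q) :
    WithProbAtLeast P (1 - q) (fun ω => F (signMap (A ω))) := by
  refine withProbAtLeast_of_measure_le hq (le_trans (le_of_eq ?_) ((hA.measure_le _).trans h))
  simp only [signMap_eq_rowSigns, Set.mem_ofPred_eq]

lemma WithProbAtLeast.imp {Ω : Type*} [MeasurableSpace Ω] {P : Measure Ω} {p q : ℝ} {E F : Ω → Prop}
    (h : WithProbAtLeast P p E) (hqp : q ≤ p) (hEF : ∀ ω, E ω → F ω) : WithProbAtLeast P q F := by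
  obtain ⟨s, hs, hE, hp⟩ := h
  exact ⟨s, hs, fun ω hω => hEF ω (hE ω hω), hqp.trans hp⟩

/-- Separation costs a factor `2` since `δ < 1`; the upper part is trivial, both quantities lying in
`[0, 1]`. -/
lemma IsLocalBinaryEmbedding.of_half {n m : ℕ} {δ : ℝ} (hδ : 1 / 2 ≤ δ) (hδ1 : δ < 1)
    {f : EuclideanSpace ℝ (Fin n) → (Fin m → Bool)} {K : Set (EuclideanSpace ℝ (Fin n))}
    (h : IsLocalBinaryEmbedding (1 / 100) 5 (1 / 2) f K) :
    IsLocalBinaryEmbedding (1 / 200) 5 δ f K := by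
  refine ⟨fun x hx y hy hxy => ?_, fun x _ y _ _ => ?_⟩
  · have := h.1 x hx y hy (hδ.trans hxy)
    linarith
  · have h1 := normHamming_nonneg (f x) (f y)
    have h2 := normHamming_le_one (f x) (f y)
    have h3 := ang_nonneg x y
    have h4 := ang_le_one x y
    rw [abs_le]
    constructor <;> linarith

lemma IsLocalBinaryEmbedding.mono_left {n m : ℕ} {c c' C δ : ℝ} (hδ : 0 ≤ δ) (hc : c' ≤ c)
    {f : EuclideanSpace ℝ (Fin n) → (Fin m → Bool)} {K : Set (EuclideanSpace ℝ (Fin n))}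
    (h : IsLocalBinaryEmbedding c C δ f K) : IsLocalBinaryEmbedding c' C δ f K :=
  ⟨fun x hx y hy hxy => (mul_le_mul_of_nonneg_right hc hδ).trans (h.1 x hx y hy hxy), h.2⟩

/-- For `δ` bounded away from zero, the hypotheses at scale `δ` yield those at scale `1 / 2`. -/
lemma half_scale_hypotheses {n : ℕ} {K : Set (EuclideanSpace ℝ (Fin n))}
    (hK : K ⊆ Metric.sphere 0 1) {r ε C M : ℝ} (hr : 0 < r) (hrε : r ≤ ε)
    (hC : C = 64 / r ^ 2 + 162 / r ^ 4)
    (hN : 8 * 10 ^ 12 * (1 + C) * logCoveringNumber K ε ≤ M)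
    (hω : 8 * 10 ^ 12 * (1 + C) * gaussianWidth (localSet K ε) ^ 2 ≤ M) :
    10 ^ 12 * logCoveringNumber K r ≤ M / 4 ∧
      10 ^ 12 * gaussianWidth (localSet K r) ^ 2 ≤ M / 8 := by
  have hC0 : 0 < C := by rw [hC]; positivity
  have hl := logCoveringNumber_nonneg K ε
  have hle := logCoveringNumber_le_add hK hr hrε
  rw [← hC] at hle
  set w := gaussianWidth (localSet K ε) ^ 2 with hw
  set l := logCoveringNumber K ε
  have hw0 : 0 ≤ w := sq_nonneg _
  have hCl : 0 ≤ C * l := by positivity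
  have hCw : 0 ≤ C * w := by positivity
  refine ⟨by linarith, ?_⟩
  have hle2 : gaussianWidth (localSet K r) ^ 2 ≤ w := by
    rcases K.eq_empty_or_nonempty with rfl | hne
    · have e : localSet (∅ : Set (EuclideanSpace ℝ (Fin n))) r = ∅ := by ext; simp [localSet]
      rw [e, hw]
      have : gaussianWidth (∅ : Set (EuclideanSpace ℝ (Fin n))) = 0 := by
        simp [gaussianWidth]
      rw [this]; simp [sq_nonneg]
    · have h0 := gaussianWidth_nonneg localSet_norm_le (zero_mem_localSet hne hr.le)
      have := gaussianWidth_mono (σ := ε) localSet_norm_le ⟨0, zero_mem_localSet hne hr.le⟩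
        (localSet_mono (K := K) hrε)
      rw [hw]
      gcongr
  linarith

theorem theorem3 :
    ∃ c c₁ c₂ cLow cUp : ℝ, 0 < c ∧ 0 < c₁ ∧ 0 < c₂ ∧ 0 < cLow ∧ 0 < cUp ∧
      ∀ (n m : ℕ) (Ω : Type*) [MeasurableSpace Ω] (P : Measure Ω) [IsProbabilityMeasure P]
        (A : Ω → Matrix (Fin m) (Fin n) ℝ), IsStdGaussianMatrix P A →
      ∀ (K : Set (EuclideanSpace ℝ (Fin n))), K ⊆ Metric.sphere 0 1 →
      ∀ (δ : ℝ), 0 < δ → δ < 1 →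
      ∀ (ε : ℝ), ε = c * δ / Real.sqrt (Real.log δ⁻¹) →
        (c₁ * max (δ⁻¹ ^ 2 * logCoveringNumber K ε)
              (δ⁻¹ ^ 3 * gaussianWidth (localSet K ε) ^ 2) ≤ (m : ℝ) →
          WithProbAtLeast P (1 - Real.exp (-(c₂ * δ ^ 2 * m)))
            (fun ω => IsBinaryEmbedding δ (signMap (A ω)) K)) ∧
        (c₁ * max (δ⁻¹ * logCoveringNumber K ε)
              (δ⁻¹ ^ 3 * gaussianWidth (localSet K ε) ^ 2) ≤ (m : ℝ) →
          WithProbAtLeast P (1 - Real.exp (-(c₂ * δ * m)))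
            (fun ω => IsLocalBinaryEmbedding cLow cUp δ (signMap (A ω)) K)) := by
  -- The net radius that belongs to the scale `1 / 2`; being absolute, it makes `C` and `c₁`
  -- absolute.
  set r : ℝ := 1 / 5120000 * (1 / 2) / √(Real.log (1 / 2)⁻¹) with hr
  have hr0 : 0 < r := (net_radius_bounds (by norm_num) le_rfl hr).1
  set C : ℝ := 64 / r ^ 2 + 162 / r ^ 4 with hC
  have hC0 : 0 < C := by positivity
  -- The rate `1 / 25600` is `(1/2)² / 6400`, the global rate at scale `1/2`; `1 / 200` is what
  -- `of_half` leaves of `1 / 100`.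
  refine ⟨1 / 5120000, 8 * 10 ^ 12 * (1 + C), 1 / 25600, 1 / 200, 5, by norm_num, by positivity,
    by norm_num, by norm_num, by norm_num, ?_⟩
  intro n m Ω _ P _ A hA K hK δ hδ hδ1 ε hε
  set c₁ : ℝ := 8 * 10 ^ 12 * (1 + C) with hc₁
  have hc₁0 : 0 < c₁ := by positivity
  have hc₁12 : (10 : ℝ) ^ 12 ≤ c₁ := by rw [hc₁]; linarith
  have hl0 := logCoveringNumber_nonneg K ε
  set l := logCoveringNumber K ε with hl
  set w := gaussianWidth (localSet K ε) ^ 2 with hw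
  have hw0 : 0 ≤ w := sq_nonneg _
  have hm0 : (0 : ℝ) ≤ m := Nat.cast_nonneg m
  have hmul : ∀ (j : ℕ) (z b : ℝ), 0 ≤ z → z ≤ b → c₁ * b ≤ m → ∀ v, z = δ⁻¹ ^ j * v →
      c₁ * v ≤ δ ^ j * m := by
    intro j z b _ hzb hb v hv
    have e : v = δ ^ j * z := by rw [hv, ← mul_assoc, ← mul_pow, mul_inv_cancel₀ hδ.ne']; simp
    have h1 : c₁ * z ≤ m := (mul_le_mul_of_nonneg_left hzb hc₁0.le).trans hb
    rw [e]
    calc c₁ * (δ ^ j * z) = δ ^ j * (c₁ * z) := by ring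
      _ ≤ δ ^ j * m := by gcongr
  have hsq : δ ^ 2 ≤ 1 := pow_le_one₀ hδ.le hδ1.le
  have hcb : δ ^ 3 ≤ 1 := pow_le_one₀ hδ.le hδ1.le
  have hdm0 : 0 ≤ δ ^ 2 * m := by positivity
  have hdm1 : 0 ≤ δ * m := by positivity
  have hdm : δ * m ≤ m := by nlinarith
  have hdm2 : δ ^ 2 * m ≤ m := by nlinarith
  have hdm3 : δ ^ 3 * m ≤ m := by nlinarith
  -- `δ / √(log (1/δ))` is increasing in `δ`, so for `δ ≥ 1/2` the given net is the coarser one.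
  have hrε : 1 / 2 ≤ δ → r ≤ ε := by
    intro h
    rw [hr, hε]
    have hlog : Real.log δ⁻¹ ≤ Real.log (1 / 2)⁻¹ := by
      apply Real.log_le_log (by positivity)
      gcongr
    have hpos : 0 < √(Real.log δ⁻¹) := Real.sqrt_pos.2 (Real.log_pos (one_lt_inv_iff₀.2 ⟨hδ, hδ1⟩))
    gcongr
  constructor
  · intro hm
    have hN := hmul 2 _ _ (by positivity) (le_max_left _ _) hm l rfl
    have hω := hmul 3 _ _ (by positivity) (le_max_right _ _) hm w rfl
    rcases le_or_gt δ (1 / 2) with hδ2 | hδ2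
    · have h := measure_not_isBinaryEmbedding_le (m := m) hK hδ hδ2 hε
        ((mul_le_mul_of_nonneg_right hc₁12 hl0).trans hN)
        ((mul_le_mul_of_nonneg_right hc₁12 hw0).trans hω)
      refine (hA.withProbAtLeast (F := fun f => IsBinaryEmbedding δ f K)
        (Real.exp_pos _).le h).imp ?_ fun _ h => h
      have : Real.exp (-(δ ^ 2 * m / 6400)) ≤ Real.exp (-(1 / 25600 * δ ^ 2 * m)) := by
        rw [Real.exp_le_exp]; linarith
      linarith
    · obtain ⟨h1, h2⟩ := half_scale_hypotheses hK hr0 (hrε hδ2.le) hC (hN.trans hdm2) (hω.trans hdm3)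
      have h := measure_not_isBinaryEmbedding_le (m := m) hK (δ := 1 / 2) (by norm_num) le_rfl hr
        (by linarith) (by linarith)
      refine (hA.withProbAtLeast (F := fun f => IsBinaryEmbedding (1 / 2) f K)
        (Real.exp_pos _).le h).imp ?_ fun _ h x hx y hy => (h x hx y hy).trans hδ2.le
      have : Real.exp (-((1 / 2) ^ 2 * m / 6400)) ≤ Real.exp (-(1 / 25600 * δ ^ 2 * m)) := by
        rw [Real.exp_le_exp]; linarith
      linarith
  · intro hm
    have hN := hmul 1 _ _ (by positivity) (le_max_left _ _) hm l (by rw [pow_one])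
    have hω := hmul 3 _ _ (by positivity) (le_max_right _ _) hm w rfl
    rw [pow_one] at hN
    rcases le_or_gt δ (1 / 2) with hδ2 | hδ2
    · have h := measure_not_isLocalBinaryEmbedding_le (m := m) hK hδ hδ2 hε
        ((mul_le_mul_of_nonneg_right hc₁12 hl0).trans hN)
        ((mul_le_mul_of_nonneg_right hc₁12 hw0).trans hω)
      refine (hA.withProbAtLeast (F := fun f => IsLocalBinaryEmbedding (1 / 100) 5 δ f K)
        (Real.exp_pos _).le h).imp ?_ fun _ h => h.mono_left hδ.le (by norm_num)
      have : Real.exp (-(δ * m / 6400)) ≤ Real.exp (-(1 / 25600 * δ * m)) := by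
        rw [Real.exp_le_exp]; linarith
      linarith
    · obtain ⟨h1, h2⟩ := half_scale_hypotheses hK hr0 (hrε hδ2.le) hC (hN.trans hdm) (hω.trans hdm3)
      have h := measure_not_isLocalBinaryEmbedding_le (m := m) hK (δ := 1 / 2) (by norm_num) le_rfl hr
        (by linarith) (by linarith)
      refine (hA.withProbAtLeast (F := fun f => IsLocalBinaryEmbedding (1 / 100) 5 (1 / 2) f K)
        (Real.exp_pos _).le h).imp ?_ fun _ h => h.of_half hδ2.le hδ1
      have : Real.exp (-(1 / 2 * m / 6400)) ≤ Real.exp (-(1 / 25600 * δ * m)) := by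
        rw [Real.exp_le_exp]; linarith
      linarith
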